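/- Let $\beta>1$ and $0\le t\le 1-\frac1\beta$. Put $\langle y\rangle=\{y\}$ if $y\notin\mathbb Z$ and $\langle y\rangle=1$ if $y\in\mathbb Z$, let $\overline T_\beta(x)=\langle\beta x\rangle$ on $[0,1]$, and let $\overline d_\beta(x)=x_1x_2\cdots$ with $x_i=\lceil\beta\,\overline T_\beta^{\,i-1}(x)\rceil-1$. The orbit closure of $x\in[0,1]$ is the closure of $\{\overline T_\beta^{\,n}(x):n\ge0\}$; a set $S$ is invariant if $\overline T_\beta(S)=S$; a nonempty set $S$ has frequency $f$ if $\frac1n\sum_{i=1}^n x_i\to f$ for every $x\in S$, where $\overline d_\beta(x)=x_1x_2\cdots$. For an infinite word $w=w_1w_2\cdots$ put $(w)_\beta=\sum_{i\ge1}w_i\beta^{-i}$; for a finite word $w$ let $w^\omega=www\cdots$, let $|w|$ be its length and $|w|_b$ the number of its letters equal to $b$. Words are compared lexicographically. Let $s_{\alpha,0}$ and $s'_{\alpha,0}$ be the words with letters $\lfloor\alpha(n+1)\rfloor-\lfloor\alpha n\rfloor$ and $\lceil\alpha(n+1)\rceil-\lceil\alpha n\rceil$ $(n\ge0)$. A word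 $z$ is central over $\{a,b\}$, where $b=a+1$, if for some rational $m/n\in(a,b)$ in lowest terms the prefixes of length $n$ of $s_{m/n,0}$ and $s'_{m/n,0}$ are $azb$ and $bza$. Assume $\overline d_\beta(t)=as$ with an integer $a\ge0$, put $b=a+1$, and suppose that $s>a^\omega$, that $s<b^\omega$, and that for no $\alpha\in[a,b]$ one has $as=s_{\alpha,0}$ or $bs=s'_{\alpha,0}$. Then $I=[t,t+\frac1\beta]$ contains exactly one invariant $\overline T_\beta$-orbit closure, and $s$ has a longest prefix $u$ that is central over $\{a,b\}$. Either $u=a^k$ or $u=b^k$ for some $k\ge1$, or there is a unique pair of central words $p,q$ over $\{a,b\}$ with $u=pabq=qbap$. The invariant orbit closure contained in $I$ is the orbit closure of $(w^\omega)_\beta$, and it has frequency $f$, where $w$ and $f$ are as follows. (a) Let $u=a^k$ with $k\ge1$ and $s=a^kvs'$ with $|v|=k+1$. Then $v\ne a^{k+1}$ and $v\neq ba^k$. If $v<a^{k+1}$, then $s\le a^\omega$ (so this is excluded). If $a^{k+1}<v<ba^k$, then $w=ba^{k+1}$ and $f=a+\frac1{k+2}$. If $v>ba^k$, then $w=ba^k$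 and $f=a+\frac1{k+1}$. (b) Let $u=b^k$ with $k\ge1$ and $s=b^kvs'$ with $|v|=k+1$. Then $v\ne b^{k+1}$ and $v\ne ab^k$. If $v>b^{k+1}$, then $s\ge b^\omega$ (so this is excluded). If $ab^k<v<b^{k+1}$, then $w=b^{k+1}a$ and $f=b-\frac1{k+2}$. If $v<ab^k$, then $w=b^ka$ and $f=b-\frac1{k+1}$. (c) Let $u=pabq=qbap$ with $p,q$ central over $\{a,b\}$, and let $s=uxyvs'$ with letters $x,y$ and $|v|=|u|+2$. If $xy=ab$ then $v\ne uab$, and if $xy=ba$ then $v\ne uba$. (i) If $xy=ab$ and $v>uab$, or $ab<xy<ba$, or $xy=ba$ and $v<uba$, then $w=bua$ and $f=a+\frac{|u|_b+1}{|u|+2}$. (ii) If $xy=ab$ and $v<uab$, or $xy\le aa$, then $w=bqa$ and $f=a+\frac{|q|_b+1}{|q|+2}$. (iii) If $xy=ba$ and $v>uba$, or $xy\ge bb$, then $w=bpa$ and $f=a+\frac{|p|_b+1}{|p|+2}$. -/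

import Mathlib

open Set Filter Topology

namespace BetaBar

noncomputable section

/-- `⟨y⟩`: the fractional part of `y` if `y` is not an integer, and `1` if it is. -/
def angle (y : ℝ) : ℝ := if Int.fract y = 0 then 1 else Int.fract y

/-- The transformation `x ↦ ⟨β x⟩`, which maps `[0,1]` into `(0,1]`. -/
def Tbar (β x : ℝ) : ℝ := angle (β * x)

/-- The digits of `x`, indexed from `0`. For `0 < x ≤ 1` and `β > 1` they are nonnegative;
the first digit of `0` is `-1`. -/
def dbar (β x : ℝ) (n : ℕ) : ℤ := ⌈β * (Tbar β)^[n] x⌉ - 1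

/-- The number `∑_{i ≥ 1} w_i / β ^ i` represented by an infinite word `w = w_1 w_2 ⋯`
(the letters are indexed from `0` here). -/
def wordValue (β : ℝ) (w : ℕ → ℤ) : ℝ := ∑' n : ℕ, (w n : ℝ) / β ^ (n + 1)

/-- The closure of the forward orbit of `x`. -/
def orbitClosure (β x : ℝ) : Set ℝ := closure (range fun n : ℕ => (Tbar β)^[n] x)

/-- `S` is the orbit closure of some point of `[0,1]`, and it is mapped onto itself. -/
def IsInvariantOrbitClosure (β : ℝ) (S : Set ℝ) : Prop :=
  (∃ x ∈ Icc (0 : ℝ) 1, S = orbitClosure β x) ∧ Tbar β '' S = S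

/-- The point `x` has frequency `f`: the digits of `x` average to `f`. -/
def PointHasFrequency (β x f : ℝ) : Prop :=
  Tendsto (fun n : ℕ => (∑ k ∈ Finset.range n, (dbar β x k : ℝ)) / (n : ℝ)) atTop (𝓝 f)

/-- The nonempty set `S` has frequency `f`: every point of `S` has frequency `f`. -/
def SetHasFrequency (β : ℝ) (S : Set ℝ) (f : ℝ) : Prop :=
  S.Nonempty ∧ ∀ x ∈ S, PointHasFrequency β x f

/-- Concatenation of a finite word and an infinite word. -/
def concat (w : List ℤ) (s : ℕ → ℤ) : ℕ → ℤ :=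
  fun n => if h : n < w.length then w[n] else s (n - w.length)

/-- The infinite word `w w w ⋯` (for nonempty `w`). -/
def omegaPower (w : List ℤ) : ℕ → ℤ := fun n => w.getD (n % w.length) 0

/-- The lower mechanical word of slope `α` and intercept `ρ`. -/
def lowerMechanical (α ρ : ℝ) (n : ℕ) : ℤ := ⌊α * (n + 1) + ρ⌋ - ⌊α * n + ρ⌋

/-- The upper mechanical word of slope `α` and intercept `ρ`. -/
def upperMechanical (α ρ : ℝ) (n : ℕ) : ℤ := ⌈α * (n + 1) + ρ⌉ - ⌈α * n + ρ⌉

/-- For coprime `m` and `n ≥ 1`, the lower Christoffel word of slope `m / n`: the period word of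
the lower mechanical word of slope `m / n` and intercept `0`, whose shortest period is `n`. -/
def lowerChristoffel (m n : ℕ) : List ℤ :=
  (List.range n).map (lowerMechanical ((m : ℝ) / (n : ℝ)) 0)

/-- The upper Christoffel word of slope `m / n`, likewise. -/
def upperChristoffel (m n : ℕ) : List ℤ :=
  (List.range n).map (upperMechanical ((m : ℝ) / (n : ℝ)) 0)

/-- `z` is a central word over `{a, b}`: for some noninteger rational `m / n` in lowest terms, the
lower and upper Christoffel words are `a z b` and `b z a`.
(These equations force `a + 1 = b = ⌈m / n⌉`.) -/
def IsCentral (a b : ℤ) (z : List ℤ) : Prop :=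
  ∃ m n : ℕ, 0 < n ∧ Nat.Coprime m n ∧
    lowerChristoffel m n = [a] ++ z ++ [b] ∧ upperChristoffel m n = [b] ++ z ++ [a]

/-- The finite word `w` is an initial segment of the infinite word `s`. -/
def Begins (w : List ℤ) (s : ℕ → ℤ) : Prop := ∃ s' : ℕ → ℤ, s = concat w s'

/-- `u` is the longest initial segment of `s` that is a central word over `{a, b}`. -/
def IsLongestCentral (a b : ℤ) (s : ℕ → ℤ) (u : List ℤ) : Prop :=
  IsCentral a b u ∧ Begins u s ∧ ∀ w : List ℤ, IsCentral a b w → Begins w s → w.length ≤ u.length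

/-- `p` and `q` are central words over `{a, b}` with `u = p a b q = q b a p`. -/
def IsCentralPair (a b : ℤ) (u p q : List ℤ) : Prop :=
  IsCentral a b p ∧ IsCentral a b q ∧ u = p ++ [a, b] ++ q ∧ u = q ++ [b, a] ++ p

/-- The orbit closure of the point represented by `w w w ⋯` is an invariant orbit closure, it is
contained in `[t, t + 1 / β]`, and it has frequency `f`. -/
def ContainsOrbit (β t : ℝ) (w : List ℤ) (f : ℝ) : Prop :=
  IsInvariantOrbitClosure β (orbitClosure β (wordValue β (omegaPower w))) ∧
  orbitClosure β (wordValue β (omegaPower w)) ⊆ Icc t (t + 1 / β) ∧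
  SetHasFrequency β (orbitClosure β (wordValue β (omegaPower w))) f

end

end BetaBar

open BetaBar

namespace BetaBar

/-! ### Digits and expansions -/

/-! Fix `m / n` in lowest terms with integer part `a`. The words `mech m n r` depend only on `r`
modulo `n`, the shift adds `m` to `r`, and on `0 ≤ r < n` they increase lexicographically. They
therefore form one ordered cycle. Its least word begins with `a` and its greatest with `b`; deleting
these first letters leaves `(zba)^ω` and `(zab)^ω`, where `z` is the central word of `m / n`. If `s`
lies strictly between `(zab)^ω` and `(zba)^ω` (`Between`, turned into `Encloses`), comparison of
expansions puts the values of the cycle in `(0,1]`, so that `Tbar` acts on them as the shift, and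
puts the least and the greatest value inside `I`.

The same hypothesis gives uniqueness. Let the orbit of `x` stay in `I`, and let the rank of a point
be the number of cycle points below it. On `I` only the digits `a` and `b` occur, and on either
branch the rank moves by the rotation that moves the cycle. So the orbit keeps the same cycle point
next to it, above or below, and the distance to it is multiplied by `β` at every step. Boundedness
makes the distance zero, unless the orbit passes both below the whole cycle and above it; two
consecutive such passages contradict expansion (`Encloses.mem_range_of_iterate_mem`).

It remains to find `z`. Prefix sums of central words are floors of multiples of their slope. If
central prefixes of `s` were unbounded, their slopes would determine an `α` for which `as` or `bs`
is mechanical (`exists_mechanical_of_unbounded`), so a longest one `u` exists. A central `u` is a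
power of a letter or the mediant `u = pabq = qbap` of Farey neighbours, and then `uabq` and `ubap`
are central too. Maximality of `u` prevents `s` from starting with these, and this decides every
comparison left open by the letters after `u`: one of `u`, `p`, `q`, or a power shorter by one
letter, serves as `z` (`replicate_left_cases`, `replicate_right_cases`, `pair_cases`). -/

lemma angle_pos (y : ℝ) : 0 < angle y := by
  unfold angle
  split_ifs with h
  · exact one_pos
  · exact lt_of_le_of_ne (Int.fract_nonneg y) (Ne.symm h)

lemma angle_le_one (y : ℝ) : angle y ≤ 1 := by
  unfold angle
  split_ifs with h
  · exact le_rfl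
  · exact (Int.fract_lt_one y).le

lemma ceil_sub_one_eq {y θ : ℝ} {d : ℤ} (h : y = d + θ) (h0 : 0 < θ) (h1 : θ ≤ 1) :
    ⌈y⌉ - 1 = d := by
  have : ⌈y⌉ = d + 1 := by
    rw [Int.ceil_eq_iff]
    push_cast
    constructor <;> linarith
  omega

lemma eq_ceil_add_angle (y : ℝ) : y = ((⌈y⌉ - 1 : ℤ) : ℝ) + angle y := by
  unfold angle
  split_ifs with h
  · have hy : y = ⌊y⌋ := by
      have := Int.floor_add_fract y
      rw [h] at this
      linarith
    have : ⌈y⌉ = ⌊y⌋ := by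
      conv_lhs => rw [hy]
      exact Int.ceil_intCast _
    rw [this]
    push_cast
    linarith
  · have h0 : 0 < Int.fract y := lt_of_le_of_ne (Int.fract_nonneg y) (Ne.symm h)
    have := ceil_sub_one_eq (Int.floor_add_fract y).symm h0 (Int.fract_lt_one y).le
    rw [this]
    exact (Int.floor_add_fract y).symm

lemma angle_eq {y θ : ℝ} {d : ℤ} (h : y = d + θ) (h0 : 0 < θ) (h1 : θ ≤ 1) : angle y = θ := by
  have h2 := eq_ceil_add_angle y
  rw [ceil_sub_one_eq h h0 h1] at h2
  linarith

lemma Tbar_pos (β x : ℝ) : 0 < Tbar β x := angle_pos _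

lemma Tbar_le_one (β x : ℝ) : Tbar β x ≤ 1 := angle_le_one _

lemma mul_iterate_Tbar (β x : ℝ) (k : ℕ) :
    β * (Tbar β)^[k] x = dbar β x k + (Tbar β)^[k + 1] x := by
  rw [Function.iterate_succ_apply']
  exact eq_ceil_add_angle _

lemma dbar_succ (β x : ℝ) (k : ℕ) : dbar β x (k + 1) = dbar β (Tbar β x) k := by
  simp only [dbar, Function.iterate_succ_apply]

lemma lex_lt_iff {s s' : ℕ → ℤ} :
    toLex s < toLex s' ↔ ∃ j, (∀ i < j, s i = s' i) ∧ s j < s' j := Iff.rfl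

/-! ### Lexicographic order and numerical order of expansions -/

section Expansions

variable {β : ℝ} {X Y : ℕ → ℝ} {D W : ℕ → ℤ}

lemma sub_eq_pow_mul (hX : ∀ k, β * X k = D k + X (k + 1)) (hY : ∀ k, β * Y k = W k + Y (k + 1))
    {j : ℕ} (h : ∀ i < j, W i = D i) : Y j - X j = β ^ j * (Y 0 - X 0) := by
  induction j with
  | zero => simp
  | succ j ih =>
    have h1 := ih fun i hi => h i (by omega)
    have h2 := hX j
    have h3 := hY j
    rw [h j (by omega)] at h3
    rw [pow_succ', mul_assoc, ← h1]
    linarith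

/-- At the first difference the digits differ by at least 1, and the earlier steps only scale the
gap by a power of `β`. The bound `M` is left free because it is applied before the remainders of the
smaller word are known to be at most 1. -/
lemma sub_lt_of_lex_lt (hβ : 1 < β) (hX : ∀ k, β * X k = D k + X (k + 1))
    (hY : ∀ k, β * Y k = W k + Y (k + 1)) (hX0 : ∀ k, 0 < X (k + 1)) {M : ℝ}
    (hM : ∀ k, Y k ≤ M) (h : toLex W < toLex D) :
    (Y 0 - X 0) < M - 1 ∨ Y 0 < X 0 := by
  obtain ⟨j, hj, hlt⟩ := lex_lt_iff.1 h
  have h1 := sub_eq_pow_mul hX hY hj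
  have h2 := hX j
  have h3 := hY j
  have h4 : (W j : ℝ) + 1 ≤ D j := by exact_mod_cast hlt
  have h5 := hM (j + 1)
  have h6 := hX0 j
  have h7 : β ^ (j + 1) * (Y 0 - X 0) < M - 1 := by
    rw [pow_succ', mul_assoc, ← h1]
    linarith
  by_cases h8 : Y 0 < X 0
  · exact Or.inr h8
  · left
    have h9 : 1 ≤ β ^ (j + 1) := one_le_pow₀ hβ.le
    nlinarith

lemma lt_of_lex_lt (hβ : 1 < β) (hX : ∀ k, β * X k = D k + X (k + 1))
    (hY : ∀ k, β * Y k = W k + Y (k + 1)) (hX0 : ∀ k, 0 < X (k + 1))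
    (hM : ∀ k, Y k ≤ 1) (h : toLex W < toLex D) : Y 0 < X 0 := by
  rcases sub_lt_of_lex_lt hβ hX hY hX0 hM h with h | h <;> linarith

end Expansions

lemma eq_zero_of_mul_bounded {β C : ℝ} (hβ : 1 < β) {e : ℕ → ℝ} (h : ∀ k, e (k + 1) = β * e k)
    (hC : ∀ k, |e k| ≤ C) : e 0 = 0 := by
  have h1 : ∀ k, e k = β ^ k * e 0 := by
    intro k
    induction k with
    | zero => simp
    | succ k ih => rw [h, ih, pow_succ']; ring
  by_contra h0
  have h2 : 0 < |e 0| := abs_pos.2 h0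
  obtain ⟨k, hk⟩ := pow_unbounded_of_one_lt (C / |e 0|) hβ
  have h3 := hC k
  rw [h1 k, abs_mul, abs_of_pos (by positivity)] at h3
  rw [div_lt_iff₀ h2] at hk
  linarith

/-! ### Values of words -/

lemma summable_word {β : ℝ} (hβ : 1 < β) {w : ℕ → ℤ} {C : ℝ} (hC : ∀ k, |(w k : ℝ)| ≤ C) :
    Summable fun n : ℕ => (w n : ℝ) / β ^ (n + 1) := by
  have h0 : 0 < β := by linarith
  have h1 : Summable fun n : ℕ => C / β * (1 / β) ^ n :=
    (summable_geometric_of_lt_one (by positivity) (by rw [div_lt_one h0]; exact hβ)).mul_left _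
  refine Summable.of_norm_bounded h1 fun k => ?_
  rw [Real.norm_eq_abs, abs_div, abs_of_pos (by positivity : 0 < β ^ (k + 1))]
  have : C / β * (1 / β) ^ k = C / β ^ (k + 1) := by
    rw [one_div, inv_pow, pow_succ]; field_simp
  rw [this]
  gcongr
  exact hC k

lemma mul_wordValue {β : ℝ} (hβ : 1 < β) {w : ℕ → ℤ} {C : ℝ} (hC : ∀ k, |(w k : ℝ)| ≤ C) :
    β * wordValue β w = w 0 + wordValue β fun k => w (k + 1) := by
  have h0 : 0 < β := by linarith
  unfold wordValue
  rw [(summable_word hβ hC).tsum_eq_zero_add, mul_add, ← tsum_mul_left]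
  congr 1
  · field_simp
    ring
  · refine tsum_congr fun k => ?_
    rw [pow_succ _ (k + 1)]
    field_simp

lemma wordValue_pos {β : ℝ} (hβ : 1 < β) {w : ℕ → ℤ} {C : ℝ} (hC : ∀ k, |(w k : ℝ)| ≤ C)
    (h : ∀ k, 0 ≤ w k) {k : ℕ} (hk : 0 < w k) : 0 < wordValue β w := by
  have h0 : 0 < β := by linarith
  refine (summable_word hβ hC).tsum_pos (fun k => ?_) k ?_
  · have : (0 : ℝ) ≤ w k := by exact_mod_cast h k
    positivity
  · have : (0 : ℝ) < w k := by exact_mod_cast hk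
    positivity

/-! ### Mechanical words of rational slope -/

/-- The lower mechanical word of slope `m / n` and intercept `r / n`. -/
def mech (m n r : ℤ) (i : ℕ) : ℤ := (m * (i + 1) + r) / n - (m * i + r) / n

section Mech

variable {m n : ℤ}

lemma mech_zero (r : ℤ) : mech m n r 0 = (m + r) / n - r / n := by simp [mech]

/-- Together with periodicity in `r`, this turns the shift into the rotation by `m` of the residues
modulo `n`. -/
lemma mech_succ (r : ℤ) (i : ℕ) : mech m n r (i + 1) = mech m n (r + m) i := by
  simp only [mech]; push_cast; congr 2 <;> ring

lemma mech_add_mul (hn : 0 < n) (r k : ℤ) : mech m n (r + n * k) = mech m n r := by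
  funext i
  simp only [mech]
  rw [← add_assoc, ← add_assoc, Int.add_mul_ediv_left _ _ hn.ne', Int.add_mul_ediv_left _ _ hn.ne']
  ring

lemma sum_mech (r : ℤ) (N : ℕ) :
    ∑ i ∈ Finset.range N, mech m n r i = (m * N + r) / n - r / n := by
  induction N with
  | zero => simp
  | succ N ih => rw [Finset.sum_range_succ, ih, mech]; push_cast; ring

lemma mech_eq_or {a : ℤ} (hn : 0 < n) (ha : m / n = a) (r : ℤ) (i : ℕ) :
    mech m n r i = a ∨ mech m n r i = a + 1 := by
  have h1 := Int.mul_ediv_add_emod m n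
  have h2 := Int.emod_nonneg m hn.ne'
  have h3 := Int.emod_lt_of_pos m hn
  have h4 := Int.mul_ediv_add_emod (m * (i + 1) + r) n
  have h5 := Int.emod_nonneg (m * (i + 1) + r) hn.ne'
  have h6 := Int.emod_lt_of_pos (m * (i + 1) + r) hn
  have h7 := Int.mul_ediv_add_emod (m * i + r) n
  have h8 := Int.emod_nonneg (m * i + r) hn.ne'
  have h9 := Int.emod_lt_of_pos (m * i + r) hn
  rw [ha] at h1
  unfold mech
  set P := (m * (i + 1) + r) / n
  set Q := (m * i + r) / n
  have h10 : P - Q < a + 2 := by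
    by_contra h
    nlinarith
  have h11 : a - 1 < P - Q := by
    by_contra h
    nlinarith
  omega

/-- Prefix sums telescope to floors that are monotone in `r`, once `r / n = 0`. A first difference
in the wrong direction would reverse two such sums. -/
lemma mech_lex_le (hn : 0 < n) {r r' : ℤ} (h0 : 0 ≤ r) (hr : r ≤ r') (h1 : r' < n) :
    toLex (mech m n r) ≤ toLex (mech m n r') := by
  by_contra h
  obtain ⟨j, hj, hlt⟩ := lex_lt_iff.1 (not_le.1 h)
  have h2 := sum_mech (m := m) (n := n) r (j + 1)
  have h3 := sum_mech (m := m) (n := n) r' (j + 1)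
  have h4 : (m * ((j + 1 : ℕ) : ℤ) + r) / n ≤ (m * ((j + 1 : ℕ) : ℤ) + r') / n :=
    Int.ediv_le_ediv hn (by linarith)
  rw [Int.ediv_eq_zero_of_lt h0 (by omega)] at h2
  rw [Int.ediv_eq_zero_of_lt (by omega) h1] at h3
  rw [Finset.sum_range_succ] at h2 h3
  have h5 : ∑ i ∈ Finset.range j, mech m n r' i = ∑ i ∈ Finset.range j, mech m n r i :=
    Finset.sum_congr rfl fun i hi => hj i (Finset.mem_range.1 hi)
  omega

end Mech

/-! ### The periodic orbit of rational slope -/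

/-- The number represented by the mechanical word of slope `m / n` and intercept `r / n`. -/
noncomputable def mechValue (β : ℝ) (m n r : ℤ) : ℝ := wordValue β (mech m n r)

section MechValue

variable {β : ℝ} {m n a : ℤ}

lemma mechValue_add_mul (hn : 0 < n) (r k : ℤ) :
    mechValue β m n (r + n * k) = mechValue β m n r := by
  rw [mechValue, mech_add_mul hn]; rfl

lemma mechValue_emod (hn : 0 < n) (r : ℤ) : mechValue β m n (r % n) = mechValue β m n r := by
  rw [← mechValue_add_mul hn (r % n) (r / n), Int.emod_add_mul_ediv]

lemma abs_mech_le (hn : 0 < n) (ha : m / n = a) (ha0 : 0 ≤ a) (r : ℤ) (i : ℕ) :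
    |(mech m n r i : ℝ)| ≤ a + 1 := by
  have h0 : (0 : ℝ) ≤ a := by exact_mod_cast ha0
  rcases mech_eq_or hn ha r i with h | h <;> rw [h]
  · rw [abs_of_nonneg h0]; linarith
  · push_cast; rw [abs_of_nonneg (by linarith)]

lemma mul_mechValue (hβ : 1 < β) (hn : 0 < n) (ha : m / n = a) (ha0 : 0 ≤ a) (r : ℤ) :
    β * mechValue β m n r = (mech m n r 0 : ℤ) + mechValue β m n (r + m) := by
  rw [mechValue, mul_wordValue hβ (abs_mech_le hn ha ha0 r)]
  congr 2
  funext k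
  exact mech_succ r k

lemma mul_mechValue_iter (hβ : 1 < β) (hn : 0 < n) (ha : m / n = a) (ha0 : 0 ≤ a) (r : ℤ) (k : ℕ) :
    β * mechValue β m n (r + m * k) =
      (mech m n r k : ℤ) + mechValue β m n (r + m * ((k + 1 : ℕ) : ℤ)) := by
  have h1 : mech m n (r + m * k) 0 = mech m n r k := by
    simp only [mech]; push_cast; congr 2 <;> ring
  have h2 : r + m * k + m = r + m * ((k + 1 : ℕ) : ℤ) := by push_cast; ring
  rw [mul_mechValue hβ hn ha ha0, h1, h2]

/-- For `a = 0` most letters may vanish, but a period has sum `m > 0` and so contains a positive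
letter. -/
lemma mechValue_pos (hβ : 1 < β) (hn : 0 < n) (ha : m / n = a) (ha0 : 0 ≤ a) (hm : 0 < m) (r : ℤ) :
    0 < mechValue β m n r := by
  have h0 : ∀ k, 0 ≤ mech m n r k := by
    intro k
    rcases mech_eq_or hn ha r k with h | h <;> omega
  obtain ⟨N, rfl⟩ := Int.eq_ofNat_of_zero_le hn.le
  have h1 := sum_mech (m := m) (n := (N : ℤ)) r N
  have h2 : (m * (N : ℤ) + r) / N - r / N = m := by
    rw [add_comm, Int.add_mul_ediv_right _ _ hn.ne']; ring
  rw [h2] at h1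
  obtain ⟨k, -, hk⟩ : ∃ k ∈ Finset.range N, 0 < mech m N r k := by
    by_contra! h
    have := Finset.sum_nonpos h
    omega
  exact wordValue_pos hβ (abs_mech_le hn ha ha0 r) h0 hk

lemma Tbar_mechValue (hβ : 1 < β) (hn : 0 < n) (ha : m / n = a) (ha0 : 0 ≤ a) (hm : 0 < m)
    (h1 : ∀ r, mechValue β m n r ≤ 1) (r : ℤ) :
    Tbar β (mechValue β m n r) = mechValue β m n (r + m) :=
  angle_eq (mul_mechValue hβ hn ha ha0 r) (mechValue_pos hβ hn ha ha0 hm _) (h1 _)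

lemma iterate_Tbar_mechValue (hβ : 1 < β) (hn : 0 < n) (ha : m / n = a) (ha0 : 0 ≤ a) (hm : 0 < m)
    (h1 : ∀ r, mechValue β m n r ≤ 1) (r : ℤ) (k : ℕ) :
    (Tbar β)^[k] (mechValue β m n r) = mechValue β m n (r + m * k) := by
  induction k with
  | zero => simp
  | succ k ih =>
    rw [Function.iterate_succ_apply', ih, Tbar_mechValue hβ hn ha ha0 hm h1]
    congr 1; push_cast; ring

lemma dbar_mechValue (hβ : 1 < β) (hn : 0 < n) (ha : m / n = a) (ha0 : 0 ≤ a) (hm : 0 < m)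
    (h1 : ∀ r, mechValue β m n r ≤ 1) (r : ℤ) (k : ℕ) :
    dbar β (mechValue β m n r) k = mech m n r k := by
  rw [dbar, iterate_Tbar_mechValue hβ hn ha ha0 hm h1]
  exact ceil_sub_one_eq (mul_mechValue_iter hβ hn ha ha0 r k)
    (mechValue_pos hβ hn ha ha0 hm _) (h1 _)

lemma frequency_mechValue (hβ : 1 < β) (hn : 0 < n) (ha : m / n = a) (ha0 : 0 ≤ a) (hm : 0 < m)
    (h1 : ∀ r, mechValue β m n r ≤ 1) (r : ℤ) :
    PointHasFrequency β (mechValue β m n r) ((m : ℝ) / n) := by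
  have hn' : (0 : ℝ) < n := by exact_mod_cast hn
  -- The sum telescopes, and its deviation from `N m / n` is a difference of two remainders divided
  -- by `n`.
  have key : ∀ N : ℕ, |(∑ k ∈ Finset.range N, (dbar β (mechValue β m n r) k : ℝ)) - m / n * N| ≤ 2 := by
    intro N
    have h2 : ∑ k ∈ Finset.range N, (dbar β (mechValue β m n r) k : ℝ) =
        (((m * N + r) / n - r / n : ℤ) : ℝ) := by
      rw [← sum_mech r N]
      push_cast
      exact Finset.sum_congr rfl fun k _ => by rw [dbar_mechValue hβ hn ha ha0 hm h1]
    have e1 : ((m * N + r : ℤ) : ℝ) = n * ((m * N + r) / n : ℤ) + ((m * N + r) % n : ℤ) := by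
      exact_mod_cast (Int.mul_ediv_add_emod _ n).symm
    have e2 : ((r : ℤ) : ℝ) = n * (r / n : ℤ) + (r % n : ℤ) := by
      exact_mod_cast (Int.mul_ediv_add_emod _ n).symm
    have e3 : (0 : ℝ) ≤ ((m * N + r) % n : ℤ) := by exact_mod_cast Int.emod_nonneg _ hn.ne'
    have e4 : (((m * N + r) % n : ℤ) : ℝ) ≤ n := by exact_mod_cast (Int.emod_lt_of_pos _ hn).le
    have e5 : (0 : ℝ) ≤ (r % n : ℤ) := by exact_mod_cast Int.emod_nonneg _ hn.ne'
    have e6 : ((r % n : ℤ) : ℝ) ≤ n := by exact_mod_cast (Int.emod_lt_of_pos _ hn).le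
    rw [h2, Int.cast_sub]
    set P : ℝ := (((m * N + r) / n : ℤ) : ℝ)
    set Q : ℝ := ((r / n : ℤ) : ℝ)
    push_cast at e1
    have e7 : (P - Q - m / n * N) = (((r % n : ℤ) : ℝ) - ((m * N + r) % n : ℤ)) / n := by
      field_simp
      linarith
    rw [e7, abs_div, abs_of_pos hn', div_le_iff₀ hn', abs_le]
    constructor <;> linarith
  have h3 : Tendsto (fun N : ℕ => (2 : ℝ) / N) atTop (𝓝 0) :=
    tendsto_const_div_atTop_nhds_zero_nat 2
  rw [PointHasFrequency, tendsto_iff_norm_sub_tendsto_zero]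
  refine squeeze_zero' (Eventually.of_forall fun _ => norm_nonneg _) ?_ h3
  filter_upwards [eventually_gt_atTop 0] with N hN
  have hN' : (0 : ℝ) < N := by exact_mod_cast hN
  rw [Real.norm_eq_abs, le_div_iff₀ hN']
  calc _ = |((∑ k ∈ Finset.range N, (dbar β (mechValue β m n r) k : ℝ)) / N - m / n) * N| := by
        rw [abs_mul, abs_of_pos hN']
    _ = |(∑ k ∈ Finset.range N, (dbar β (mechValue β m n r) k : ℝ)) - m / n * N| := by
        congr 1; field_simp
    _ ≤ 2 := key N

lemma orbitClosure_mechValue (hβ : 1 < β) (hn : 0 < n) (ha : m / n = a) (ha0 : 0 ≤ a) (hm : 0 < m)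
    (hco : IsCoprime m n) (h1 : ∀ r, mechValue β m n r ≤ 1) (r : ℤ) :
    orbitClosure β (mechValue β m n r) = range (mechValue β m n) := by
  have hfin : (range (mechValue β m n)).Finite := by
    refine ((Finset.Ico 0 n).finite_toSet.image (mechValue β m n)).subset ?_
    rintro _ ⟨r, rfl⟩
    refine ⟨r % n, ?_, mechValue_emod hn r⟩
    simp [Int.emod_nonneg r hn.ne', Int.emod_lt_of_pos r hn]
  have hr : (range fun k : ℕ => (Tbar β)^[k] (mechValue β m n r)) = range (mechValue β m n) := by
    apply Subset.antisymm
    · rintro _ ⟨k, rfl⟩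
      exact ⟨_, (iterate_Tbar_mechValue hβ hn ha ha0 hm h1 r k).symm⟩
    · rintro _ ⟨r', rfl⟩
      obtain ⟨u, v, huv⟩ := hco
      -- Since `u` inverts `m` modulo `n`, the residue `r'` is reached from `r` after `(r' - r) u`
      -- rotations.
      refine ⟨(((r' - r) * u) % n).toNat, ?_⟩
      simp only
      rw [iterate_Tbar_mechValue hβ hn ha ha0 hm h1, Int.toNat_of_nonneg (Int.emod_nonneg _ hn.ne')]
      have e := Int.mul_ediv_add_emod ((r' - r) * u) n
      have : r' = r + m * ((r' - r) * u % n) + n * (m * ((r' - r) * u / n) + (r' - r) * v) := by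
        linear_combination m * (-e) + (r - r') * huv
      conv_rhs => rw [this, mechValue_add_mul hn]
  rw [orbitClosure, hr]
  exact hfin.isClosed.closure_eq

end MechValue

lemma toLex_lt_of_cons {w d : ℕ → ℤ} (h0 : w 0 = d 0)
    (h : toLex (fun k => w (k + 1)) < toLex (fun k => d (k + 1))) : toLex w < toLex d := by
  obtain ⟨j, hj, hlt⟩ := lex_lt_iff.1 h
  refine lex_lt_iff.2 ⟨j + 1, fun i hi => ?_, hlt⟩
  cases i with
  | zero => exact h0
  | succ i => exact hj i (by omega)

/-- The expansion of `t` lies strictly between the words that bound the periodic orbit of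
slope `m / n`. -/
structure Encloses (β t : ℝ) (a m n : ℤ) : Prop where
  one_lt : 1 < β
  le_one_sub : t ≤ 1 - 1 / β
  nonneg : 0 ≤ a
  two_le : 2 ≤ n
  coprime : IsCoprime m n
  div_eq : m / n = a
  digit : dbar β t 0 = a
  lower : toLex (mech m n (m - 1)) < toLex (dbar β (Tbar β t))
  upper : toLex (dbar β (Tbar β t)) < toLex (mech m n m)

/-! ### The periodic orbit inside the interval, and ranks -/

namespace Encloses

variable {β t : ℝ} {a m n : ℤ}

lemma pos (h : Encloses β t a m n) : 0 < n := by have := h.two_le; omega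

lemma beta_pos (h : Encloses β t a m n) : 0 < β := by have := h.one_lt; linarith

lemma emod_pos (h : Encloses β t a m n) : 0 < m - a * n := by
  have h1 := Int.mul_ediv_add_emod m n
  have h2 := Int.emod_nonneg m h.pos.ne'
  rw [h.div_eq] at h1
  rcases h2.lt_or_eq with h3 | h3
  · linarith
  · exfalso
    have h4 : n ∣ m := Int.dvd_of_emod_eq_zero h3.symm
    have h5 := h.coprime.isUnit_of_dvd' h4 dvd_rfl
    have := h.two_le
    rcases Int.isUnit_iff.1 h5 with h6 | h6 <;> omega

lemma emod_lt (h : Encloses β t a m n) : m - a * n < n := by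
  have h1 := Int.mul_ediv_add_emod m n
  have h2 := Int.emod_lt_of_pos m h.pos
  rw [h.div_eq] at h1
  linarith

lemma num_pos (h : Encloses β t a m n) : 0 < m := by
  have h1 := h.emod_pos
  have h2 : 0 ≤ a * n := mul_nonneg h.nonneg h.pos.le
  linarith

lemma mul_left_end (h : Encloses β t a m n) : β * t = a + Tbar β t := by
  have h1 := mul_iterate_Tbar β t 0
  rw [h.digit] at h1
  simpa using h1

lemma mul_right_end (h : Encloses β t a m n) : β * (t + 1 / β) = a + 1 + Tbar β t := by
  have := h.beta_pos
  rw [mul_add, h.mul_left_end]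
  field_simp
  ring

lemma left_pos (h : Encloses β t a m n) : 0 < t := by
  have h1 := h.mul_left_end
  have h2 := Tbar_pos β t
  have h3 : (0 : ℝ) ≤ a := by exact_mod_cast h.nonneg
  have h4 : 0 < β * t := by linarith
  exact pos_of_mul_pos_right h4 h.beta_pos.le

/-- The letter of `mech m n r` at `0` for a reduced residue `r`. -/
lemma mech_zero_low (h : Encloses β t a m n) {r : ℤ} (h0 : 0 ≤ r) (h1 : r + (m - a * n) < n) :
    mech m n r 0 = a := by
  have h2 := h.emod_pos
  rw [mech_zero, Int.ediv_eq_zero_of_lt h0 (by omega)]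
  have : m + r = (m - a * n + r) + n * a := by ring
  rw [this, Int.add_mul_ediv_left _ _ h.pos.ne', Int.ediv_eq_zero_of_lt (by omega) (by omega)]
  ring

lemma mech_zero_high (h : Encloses β t a m n) {r : ℤ} (h0 : r < n) (h1 : n ≤ r + (m - a * n)) :
    mech m n r 0 = a + 1 := by
  have h2 := h.emod_lt
  have h3 := h.emod_pos
  have h4 : r / n = 0 := Int.ediv_eq_zero_of_lt (by omega) h0
  have : m + r = (m - a * n + r - n) + n * (a + 1) := by ring
  rw [mech_zero, h4, this, Int.add_mul_ediv_left _ _ h.pos.ne', Int.ediv_eq_zero_of_lt (by omega) (by omega)]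
  ring

lemma mechValue_sub (h : Encloses β t a m n) (r : ℤ) :
    mechValue β m n (r + m) = mechValue β m n (r + (m - a * n)) := by
  rw [← mechValue_add_mul h.pos (r + (m - a * n)) a]
  congr 1; ring

lemma mul_mechValue_low (h : Encloses β t a m n) {r : ℤ} (h0 : 0 ≤ r) (h1 : r + (m - a * n) < n) :
    β * mechValue β m n r = a + mechValue β m n (r + (m - a * n)) := by
  rw [mul_mechValue h.one_lt h.pos h.div_eq h.nonneg, h.mech_zero_low h0 h1, h.mechValue_sub]

lemma mul_mechValue_high (h : Encloses β t a m n) {r : ℤ} (h0 : r < n) (h1 : n ≤ r + (m - a * n)) :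
    β * mechValue β m n r = a + 1 + mechValue β m n (r + (m - a * n) - n) := by
  rw [mul_mechValue h.one_lt h.pos h.div_eq h.nonneg, h.mech_zero_high h0 h1, h.mechValue_sub,
    ← mechValue_add_mul h.pos (r + (m - a * n) - n) 1]
  push_cast
  congr 2; ring

lemma mech_zero_neg_one (h : Encloses β t a m n) : mech m n (-1) 0 = a + 1 := by
  have h1 := h.mech_zero_high (r := n - 1) (by omega) (by have := h.emod_pos; omega)
  rw [← mech_add_mul h.pos (-1) 1, ← h1]
  congr 1; ring

/-- The largest value `M` of the cycle is compared with `t + 1 / β ≤ 1`. Only `M` itself bounds the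
tails, but the alternative `M - (t + 1 / β) < M - 1` would give `t + 1 / β > 1`. -/
lemma le_one (h : Encloses β t a m n) (r : ℤ) : mechValue β m n r ≤ 1 := by
  have hn := h.pos
  obtain ⟨r₀, hr₀, hmax⟩ := Finset.exists_max_image (Finset.Ico 0 n) (mechValue β m n)
    ⟨0, by simp [hn]⟩
  have hmax' : ∀ r, mechValue β m n r ≤ mechValue β m n r₀ := by
    intro r
    rw [← mechValue_emod hn r]
    exact hmax _ (by simp [Int.emod_nonneg r hn.ne', Int.emod_lt_of_pos r hn])
  refine (hmax' r).trans ?_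
  rw [Finset.mem_Ico] at hr₀
  -- Remainders and digits of `t + 1 / β`: the letter `a + 1`, then the expansion of `Tbar β t`.
  let X : ℕ → ℝ
    | 0 => t + 1 / β
    | k + 1 => (Tbar β)^[k] (Tbar β t)
  let D : ℕ → ℤ
    | 0 => a + 1
    | k + 1 => dbar β (Tbar β t) k
  have hX : ∀ k, β * X k = ((D k : ℤ) : ℝ) + X (k + 1) := by
    intro k
    cases k with
    | zero => simpa [X, D] using h.mul_right_end
    | succ k => exact mul_iterate_Tbar β (Tbar β t) k
  have hX0 : ∀ k, 0 < X (k + 1) := by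
    intro k
    change 0 < (Tbar β)^[k] (Tbar β t)
    cases k with
    | zero => exact Tbar_pos _ _
    | succ k => rw [Function.iterate_succ_apply']; exact Tbar_pos _ _
  have hlex : toLex (mech m n r₀) < toLex D := by
    refine lt_of_le_of_lt (mech_lex_le hn hr₀.1 (by omega : r₀ ≤ n - 1) (by omega)) ?_
    have : mech m n (n - 1) = mech m n (-1) := by
      rw [← mech_add_mul hn (-1) 1]; congr 1; ring
    rw [this]
    refine toLex_lt_of_cons h.mech_zero_neg_one ?_
    have : (fun k => mech m n (-1) (k + 1)) = mech m n (m - 1) := by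
      funext k; rw [mech_succ]; congr 1; ring
    rw [this]
    exact h.lower
  have hXt : X 0 ≤ 1 := by
    have := h.le_one_sub
    change t + 1 / β ≤ 1
    linarith
  rcases sub_lt_of_lex_lt h.one_lt hX
    (Y := fun k => mechValue β m n (r₀ + m * k)) (W := mech m n r₀)
    (mul_mechValue_iter h.one_lt hn h.div_eq h.nonneg r₀) hX0 (fun k => hmax' _) hlex with h1 | h1
  · simp only [Nat.cast_zero, mul_zero, add_zero] at h1
    linarith
  · simp only [Nat.cast_zero, mul_zero, add_zero] at h1
    linarith

lemma value_pos (h : Encloses β t a m n) (r : ℤ) : 0 < mechValue β m n r :=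
  mechValue_pos h.one_lt h.pos h.div_eq h.nonneg h.num_pos r

lemma iterate_pos (x : ℝ) (hx : 0 < x) (k : ℕ) : 0 < (Tbar β)^[k] x := by
  cases k with
  | zero => exact hx
  | succ k => rw [Function.iterate_succ_apply']; exact Tbar_pos _ _

lemma iterate_le_one (x : ℝ) (hx : x ≤ 1) (k : ℕ) : (Tbar β)^[k] x ≤ 1 := by
  cases k with
  | zero => exact hx
  | succ k => rw [Function.iterate_succ_apply']; exact Tbar_le_one _ _

/-- Residue `m - a n - 1` is that of `m - 1` modulo `n`, the successor of the greatest word;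
likewise `m - a n` succeeds the least word. So `Tbar β t` falls in the gap between two neighbouring
points of the cycle. -/
lemma value_lt (h : Encloses β t a m n) : mechValue β m n (m - a * n - 1) < Tbar β t := by
  have h1 := lt_of_lex_lt h.one_lt (mul_iterate_Tbar β (Tbar β t))
    (mul_mechValue_iter h.one_lt h.pos h.div_eq h.nonneg (m - 1))
    (fun k => iterate_pos _ (Tbar_pos β t) _) (fun k => h.le_one _) h.lower
  have e : m - 1 + m * ((0 : ℕ) : ℤ) = m - a * n - 1 + n * a := by push_cast; ring
  rw [e, mechValue_add_mul h.pos] at h1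
  exact h1

lemma lt_value (h : Encloses β t a m n) : Tbar β t < mechValue β m n (m - a * n) := by
  have h1 := lt_of_lex_lt h.one_lt
    (mul_mechValue_iter h.one_lt h.pos h.div_eq h.nonneg m) (mul_iterate_Tbar β (Tbar β t))
    (fun k => h.value_pos _) (fun k => iterate_le_one _ (Tbar_le_one β t) _) h.upper
  have e : m + m * ((0 : ℕ) : ℤ) = m - a * n + n * a := by push_cast; ring
  rw [e, mechValue_add_mul h.pos] at h1
  exact h1

lemma value_mono (h : Encloses β t a m n) {r r' : ℤ} (h0 : 0 ≤ r) (hr : r ≤ r') (h1 : r' < n) :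
    mechValue β m n r ≤ mechValue β m n r' := by
  rcases (mech_lex_le (m := m) h.pos h0 hr h1).lt_or_eq with h2 | h2
  · have h3 := lt_of_lex_lt h.one_lt
      (mul_mechValue_iter h.one_lt h.pos h.div_eq h.nonneg r')
      (mul_mechValue_iter h.one_lt h.pos h.div_eq h.nonneg r)
      (fun k => h.value_pos _) (fun k => h.le_one _) h2
    simpa using h3.le
  · have h3 : mech m n r = mech m n r' := h2
    rw [mechValue, mechValue, h3]

/-- By monotonicity only residues `0` and `n - 1` matter. One step maps the end points of the
interval to `Tbar β t` and these two points to its two neighbours in the cycle. -/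
lemma value_mem (h : Encloses β t a m n) (r : ℤ) : mechValue β m n r ∈ Icc t (t + 1 / β) := by
  have hn := h.pos
  have hβ := h.beta_pos
  have h1 := h.emod_pos
  have h2 := h.emod_lt
  rw [← mechValue_emod hn r]
  have h3 := Int.emod_nonneg r hn.ne'
  have h4 := Int.emod_lt_of_pos r hn
  constructor
  · refine le_trans ?_ (h.value_mono le_rfl h3 h4)
    have h5 := h.mul_mechValue_low le_rfl (by omega)
    rw [zero_add] at h5
    have h6 := h.mul_left_end
    have h7 := h.lt_value
    nlinarith
  · refine le_trans (h.value_mono h3 (by omega : r % n ≤ n - 1) (by omega)) ?_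
    have h5 := h.mul_mechValue_high (r := n - 1) (by omega) (by omega)
    have : n - 1 + (m - a * n) - n = m - a * n - 1 := by ring
    rw [this] at h5
    have h6 := h.mul_right_end
    have h7 := h.value_lt
    nlinarith

/-- `g` is the number of residues `r` with `mechValue β m n r < y`. -/
def Rank (β : ℝ) (m n : ℤ) (y : ℝ) (g : ℤ) : Prop :=
  0 ≤ g ∧ g ≤ n ∧ ∀ r, 0 ≤ r → r < n → (mechValue β m n r < y ↔ r < g)

lemma exists_rank (h : Encloses β t a m n) (y : ℝ) : ∃ g, Rank β m n y g := by
  classical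
  obtain ⟨N, rfl⟩ := Int.eq_ofNat_of_zero_le h.pos.le
  have hex : ∃ r : ℕ, N ≤ r ∨ y ≤ mechValue β m N r := ⟨N, Or.inl le_rfl⟩
  refine ⟨Nat.find hex, by omega, by exact_mod_cast Nat.find_min' hex (Or.inl le_rfl), ?_⟩
  intro r hr0 hr1
  obtain ⟨r, rfl⟩ := Int.eq_ofNat_of_zero_le hr0
  constructor
  · intro hlt
    by_contra hge
    rcases Nat.find_spec hex with h1 | h1
    · omega
    · have := h.value_mono (by omega) (not_lt.1 hge) hr1
      linarith
  · intro hlt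
    have := Nat.find_min hex (by exact_mod_cast hlt : r < Nat.find hex)
    push Not at this
    exact this.2

/-- The `m - a n` lowest cycle points lie below `Tbar β t ≤ y`. The others are images, under the
increasing branch with digit `a`, of the points with residue smaller by `m - a n`, so they lie below
`y` exactly when these lie below `x`. -/
lemma rank_low (h : Encloses β t a m n) {x y : ℝ} {g : ℤ} (hg : Rank β m n x g)
    (hxy : β * x = a + y) (hy1 : y ≤ 1) (hty : Tbar β t ≤ y) :
    Rank β m n y (g + (m - a * n)) := by
  obtain ⟨g0, g1, g2⟩ := hg
  have hβ := h.beta_pos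
  have h1 := h.emod_pos
  have h2 := h.emod_lt
  refine ⟨by omega, ?_, fun r hr0 hr1 => ?_⟩
  -- This is the least residue with letter `a + 1`; its value times `β` exceeds `a + 1 ≥ β x`, so
  -- the rank of `x` does not count it.
  · have h3 := g2 (n - (m - a * n)) (by omega) (by omega)
    have h4 := h.mul_mechValue_high (r := n - (m - a * n)) (by omega) (by omega)
    have h5 := h.value_pos (n - (m - a * n) + (m - a * n) - n)
    by_contra hc
    have := h3.2 (by omega)
    nlinarith
  · by_cases hr : r < m - a * n
    · have h3 := h.value_mono hr0 (by omega : r ≤ m - a * n - 1) (by omega)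
      have h4 := h.value_lt
      exact ⟨fun _ => by omega, fun _ => by linarith⟩
    · have h3 := g2 (r - (m - a * n)) (by omega) (by omega)
      have h4 := h.mul_mechValue_low (r := r - (m - a * n)) (by omega) (by omega)
      rw [sub_add_cancel] at h4
      have h5 : mechValue β m n r < y ↔ mechValue β m n (r - (m - a * n)) < x := by
        constructor <;> intro h6 <;> nlinarith
      rw [h5, h3]
      omega

/-- Mirror image of `rank_low`: now the points with residue at least `m - a n` are above `Tbar β t ≥
y`, and the rest are images under the branch with digit `a + 1`. -/
lemma rank_high (h : Encloses β t a m n) {x y : ℝ} {g : ℤ} (hg : Rank β m n x g)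
    (hxy : β * x = a + 1 + y) (hy0 : 0 < y) (hty : y ≤ Tbar β t) :
    Rank β m n y (g + (m - a * n) - n) := by
  obtain ⟨g0, g1, g2⟩ := hg
  have hβ := h.beta_pos
  have h1 := h.emod_pos
  have h2 := h.emod_lt
  refine ⟨?_, by omega, fun r hr0 hr1 => ?_⟩
  · have h3 := g2 (n - (m - a * n) - 1) (by omega) (by omega)
    have h4 := h.mul_mechValue_low (r := n - (m - a * n) - 1) (by omega) (by omega)
    have h5 := h.le_one (n - (m - a * n) - 1 + (m - a * n))
    have := h3.1 (by nlinarith)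
    omega
  · by_cases hr : r < m - a * n
    · have h3 := g2 (r - (m - a * n) + n) (by omega) (by omega)
      have h4 := h.mul_mechValue_high (r := r - (m - a * n) + n) (by omega) (by omega)
      have : r - (m - a * n) + n + (m - a * n) - n = r := by ring
      rw [this] at h4
      have h5 : mechValue β m n r < y ↔ mechValue β m n (r - (m - a * n) + n) < x := by
        constructor <;> intro h6 <;> nlinarith
      rw [h5, h3]
      omega
    · have h3 := h.value_mono h1.le (not_lt.1 hr) hr1
      have h4 := h.lt_value
      exact ⟨fun _ => by linarith, fun _ => by omega⟩

lemma rank_unique {y : ℝ} {g g' : ℤ} (hg : Rank β m n y g) (hg' : Rank β m n y g') : g = g' := by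
  obtain ⟨g0, g1, g2⟩ := hg
  obtain ⟨g0', g1', g2'⟩ := hg'
  rcases lt_trichotomy g g' with hlt | rfl | hlt
  · have := (g2 g g0 (by omega)).1 ((g2' g g0 (by omega)).2 hlt)
    omega
  · rfl
  · have := (g2' g' g0' (by omega)).1 ((g2 g' g0' (by omega)).2 hlt)
    omega

end Encloses

lemma exists_consecutive {A B : ℕ → Prop} {i j : ℕ} (hij : i < j) (hA : A i) (hB : B j) :
    ∃ i₀ j₀, i₀ < j₀ ∧ A i₀ ∧ B j₀ ∧ ∀ l, i₀ < l → l < j₀ → ¬ A l ∧ ¬ B l := by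
  induction hd : j - i using Nat.strong_induction_on generalizing i j with
  | _ d ih =>
    by_cases h : ∀ l, i < l → l < j → ¬ A l ∧ ¬ B l
    · exact ⟨i, j, hij, hA, hB, h⟩
    · push Not at h
      obtain ⟨l, h1, h2, h3⟩ := h
      by_cases hl : A l
      · exact ih (j - l) (by omega) h2 hl hB rfl
      · exact ih (l - i) (by omega) h1 hA (by tauto) rfl

/-! ### Uniqueness of the orbit in the interval -/

namespace Encloses

variable {β t : ℝ} {a m n : ℤ}

/-- Every point whose forward orbit stays in `[t, t + 1 / β]` lies on the periodic orbit. -/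
theorem mem_range_of_iterate_mem (h : Encloses β t a m n) {x : ℝ}
    (hx : ∀ k, (Tbar β)^[k] x ∈ Icc t (t + 1 / β)) : ∃ r, mechValue β m n r = x := by
  have hβ := h.one_lt
  have hβ0 := h.beta_pos
  have hn := h.pos
  have e1 := h.emod_pos
  have e2 := h.emod_lt
  have e3 := h.mul_left_end
  have e4 := h.mul_right_end
  have e5 := Tbar_pos β t
  have e6 := Tbar_le_one β t
  set X : ℕ → ℝ := fun k => (Tbar β)^[k] x with hX
  have hX0 : X 0 = x := rfl
  choose g hg using fun k => h.exists_rank (X k)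
  have hstep : ∀ k, (Tbar β t ≤ X (k + 1) ∧ β * X k = a + X (k + 1) ∧
      g (k + 1) = g k + (m - a * n)) ∨ (X (k + 1) ≤ Tbar β t ∧ β * X k = a + 1 + X (k + 1) ∧
      g (k + 1) = g k + (m - a * n) - n) := by
    intro k
    have h1 : β * X k = dbar β x k + X (k + 1) := mul_iterate_Tbar β x k
    have h2 : 0 < X (k + 1) := by
      simp only [hX, Function.iterate_succ_apply']; exact Tbar_pos _ _
    have h3 : X (k + 1) ≤ 1 := by
      simp only [hX, Function.iterate_succ_apply']; exact Tbar_le_one _ _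
    have h4 : β * t ≤ β * X k := by have := (hx k).1; gcongr
    have h5 : β * X k ≤ β * (t + 1 / β) := by have := (hx k).2; gcongr
    have h6 : a - 1 < dbar β x k := by
      have : (a : ℝ) - 1 < dbar β x k := by linarith
      exact_mod_cast this
    have h7 : dbar β x k < a + 2 := by
      have : (dbar β x k : ℝ) < a + 2 := by linarith
      exact_mod_cast this
    rcases (by omega : dbar β x k = a ∨ dbar β x k = a + 1) with h8 | h8
    · rw [h8] at h1
      have h9 : Tbar β t ≤ X (k + 1) := by linarith
      exact Or.inl ⟨h9, h1, rank_unique (hg (k + 1)) (h.rank_low (hg k) h1 h3 h9)⟩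
    · rw [h8] at h1
      push_cast at h1
      have h9 : X (k + 1) ≤ Tbar β t := by linarith
      exact Or.inr ⟨h9, h1, rank_unique (hg (k + 1)) (h.rank_high (hg k) h1 h2 h9)⟩
  -- The index `g k - c` names the cycle point next to `X k`: at or above it for `c = 0`, strictly
  -- below it for `c = 1`. While the index stays in `[0, n)`, both points follow the same branch.
  have herr : ∀ c k, 0 ≤ g k - c → g k - c < n → 0 ≤ g (k + 1) - c → g (k + 1) - c < n →
      X (k + 1) - mechValue β m n (g (k + 1) - c) = β * (X k - mechValue β m n (g k - c)) := by
    intro c k k0 k1 k2 k3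
    rcases hstep k with ⟨-, h1, h2⟩ | ⟨-, h1, h2⟩
    · have h3 := h.mul_mechValue_low k0 (by omega)
      have : g (k + 1) - c = g k - c + (m - a * n) := by omega
      rw [this]
      linarith
    · have h3 := h.mul_mechValue_high k1 (by omega)
      have : g (k + 1) - c = g k - c + (m - a * n) - n := by omega
      rw [this]
      linarith
  have hgrow : ∀ c k N, (∀ i ≤ N, 0 ≤ g (k + i) - c ∧ g (k + i) - c < n) →
      X (k + N) - mechValue β m n (g (k + N) - c) = β ^ N * (X k - mechValue β m n (g k - c)) := by
    intro c k N
    induction N with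
    | zero => simp
    | succ N ih =>
      intro hi
      have h1 := hi N (by omega)
      have h2 := hi (N + 1) le_rfl
      rw [← add_assoc, herr c (k + N) h1.1 h1.2 h2.1 h2.2, ih fun i hi' => hi i (by omega), pow_succ']
      ring
  have halways : ∀ c, (∀ k, 0 ≤ g k - c ∧ g k - c < n) → ∃ r, mechValue β m n r = x := by
    intro c hc
    refine ⟨g 0 - c, ?_⟩
    have := eq_zero_of_mul_bounded (C := t + 1 / β) hβ
      (e := fun k => X k - mechValue β m n (g k - c))
      (fun k => herr c k (hc k).1 (hc k).2 (hc (k + 1)).1 (hc (k + 1)).2) (fun k => by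
        have h1 := hx k
        have h2 := h.value_mem (g k - c)
        have h3 := h.left_pos
        rw [mem_Icc] at h1 h2
        rw [abs_le]
        constructor <;> simp only [hX] <;> linarith)
    simp only [hX0] at this
    linarith
  have hpow : ∀ N : ℕ, 0 < N → 1 < β ^ N := fun N hN => one_lt_pow₀ hβ hN.ne'
  -- For `c = 0` the index leaves `[0, n)` only at rank `n`, for `c = 1` only at rank `0`.
  by_cases hA : ∀ k, g k ≠ n
  · exact halways 0 fun k => by have := hg k; have := hA k; unfold Rank at *; omega
  by_cases hB : ∀ k, g k ≠ 0
  · exact halways 1 fun k => by have := hg k; have := hB k; unfold Rank at *; omega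
  push Not at hA hB
  obtain ⟨k₁, hk₁⟩ := hA
  obtain ⟨k₀, hk₀⟩ := hB
  exfalso
  have hlo : ∀ k, g k = 0 → g (k + 1) = m - a * n ∧ Tbar β t ≤ X (k + 1) := by
    intro k hk
    have := (hg (k + 1)).1
    rcases hstep k with ⟨h1, -, h2⟩ | ⟨-, -, h2⟩
    · exact ⟨by omega, h1⟩
    · omega
  have hhi : ∀ k, g k = n → g (k + 1) = m - a * n ∧ X (k + 1) ≤ Tbar β t := by
    intro k hk
    have := (hg (k + 1)).2.1
    rcases hstep k with ⟨-, -, h2⟩ | ⟨h1, -, h2⟩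
    · omega
    · exact ⟨by omega, h1⟩
  rcases lt_trichotomy k₀ k₁ with hlt | heq | hlt
  -- Both passages end at rank `m - a n`, hence with the same lower neighbour, which lies below
  -- `Tbar β t`. Expansion must increase the positive distance to it, yet the orbit goes from at
  -- least `Tbar β t` to at most `Tbar β t`.
  · obtain ⟨i, j, hij, hi, hj, hbetween⟩ :=
      exists_consecutive (A := fun k => g k = 0) (B := fun k => g k = n) hlt hk₀ hk₁
    obtain ⟨p1, p2⟩ := hlo i hi
    obtain ⟨q1, q2⟩ := hhi j hj
    obtain ⟨N, rfl⟩ := Nat.exists_eq_add_of_lt hij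
    have h1 := hgrow 1 (i + 1) (N + 1) fun l hl => by
      have h2 := hg (i + 1 + l)
      unfold Rank at h2
      rcases lt_trichotomy l N with h3 | h3 | h3
      · have := hbetween (i + 1 + l) (by omega) (by omega)
        omega
      · have : i + 1 + l = i + N + 1 := by omega
        rw [this] at h2 ⊢
        omega
      · have : i + 1 + l = i + N + 1 + 1 := by omega
        rw [this] at h2 ⊢
        omega
    have h2 : i + 1 + (N + 1) = i + N + 1 + 1 := by omega
    rw [h2, q1, p1] at h1
    have h3 := hpow (N + 1) (by omega)
    have h4 := h.value_lt
    nlinarith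
  · subst heq
    omega
  -- The reverse order of passages, measured against the upper neighbour.
  · obtain ⟨i, j, hij, hi, hj, hbetween⟩ :=
      exists_consecutive (A := fun k => g k = n) (B := fun k => g k = 0) hlt hk₁ hk₀
    obtain ⟨p1, p2⟩ := hhi i hi
    obtain ⟨q1, q2⟩ := hlo j hj
    obtain ⟨N, rfl⟩ := Nat.exists_eq_add_of_lt hij
    have h1 := hgrow 0 (i + 1) (N + 1) fun l hl => by
      have h2 := hg (i + 1 + l)
      unfold Rank at h2
      rcases lt_trichotomy l N with h3 | h3 | h3
      · have := hbetween (i + 1 + l) (by omega) (by omega)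
        omega
      · have : i + 1 + l = i + N + 1 := by omega
        rw [this] at h2 ⊢
        omega
      · have : i + 1 + l = i + N + 1 + 1 := by omega
        rw [this] at h2 ⊢
        omega
    have h2 : i + 1 + (N + 1) = i + N + 1 + 1 := by omega
    rw [h2, q1, p1, sub_zero] at h1
    have h3 := hpow (N + 1) (by omega)
    have h4 := h.lt_value
    nlinarith

lemma mem_orbitClosure (β x : ℝ) (k : ℕ) : (Tbar β)^[k] x ∈ orbitClosure β x :=
  subset_closure ⟨k, rfl⟩

lemma orbitClosure_eq (h : Encloses β t a m n) (r : ℤ) :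
    orbitClosure β (mechValue β m n r) = range (mechValue β m n) :=
  orbitClosure_mechValue h.one_lt h.pos h.div_eq h.nonneg h.num_pos h.coprime h.le_one r

theorem eq_range_of_isInvariantOrbitClosure (h : Encloses β t a m n) {S : Set ℝ}
    (hS : IsInvariantOrbitClosure β S) (hI : S ⊆ Icc t (t + 1 / β)) :
    S = range (mechValue β m n) := by
  obtain ⟨⟨x, -, rfl⟩, -⟩ := hS
  obtain ⟨r, rfl⟩ := h.mem_range_of_iterate_mem fun k => hI (mem_orbitClosure β x k)
  exact h.orbitClosure_eq r

theorem isInvariantOrbitClosure (h : Encloses β t a m n) :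
    IsInvariantOrbitClosure β (range (mechValue β m n)) := by
  have hT := Tbar_mechValue h.one_lt h.pos h.div_eq h.nonneg h.num_pos h.le_one
  refine ⟨⟨mechValue β m n 0, ⟨(h.value_pos 0).le, h.le_one 0⟩, (h.orbitClosure_eq 0).symm⟩, ?_⟩
  apply Subset.antisymm
  · rintro _ ⟨_, ⟨r, rfl⟩, rfl⟩
    exact ⟨r + m, (hT r).symm⟩
  · rintro _ ⟨r, rfl⟩
    exact ⟨_, ⟨r - m, rfl⟩, by rw [hT]; congr 1; ring⟩

theorem setHasFrequency (h : Encloses β t a m n) :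
    SetHasFrequency β (range (mechValue β m n)) ((m : ℝ) / n) := by
  refine ⟨range_nonempty _, ?_⟩
  rintro _ ⟨r, rfl⟩
  exact frequency_mechValue h.one_lt h.pos h.div_eq h.nonneg h.num_pos h.le_one r

theorem range_subset (h : Encloses β t a m n) :
    range (mechValue β m n) ⊆ Icc t (t + 1 / β) := by
  rintro _ ⟨r, rfl⟩
  exact h.value_mem r

end Encloses

/-! ### Central words -/

lemma ediv_eq_of_bounds {x q n : ℤ} (hn : 0 < n) (h1 : q * n ≤ x) (h2 : x < (q + 1) * n) :
    x / n = q :=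
  le_antisymm (Int.lt_add_one_iff.1 ((Int.ediv_lt_iff_lt_mul hn).2 h2)) ((Int.le_ediv_iff_mul_le hn).2 h1)

lemma sub_one_ediv {x n : ℤ} (hn : 0 < n) (h : ¬ n ∣ x) : (x - 1) / n = x / n := by
  have h1 := Int.mul_ediv_add_emod x n
  have h2 := Int.emod_nonneg x hn.ne'
  have h3 := Int.emod_lt_of_pos x hn
  have h4 : x % n ≠ 0 := fun h5 => h (Int.dvd_of_emod_eq_zero h5)
  have h5 : 1 ≤ x % n := by omega
  apply ediv_eq_of_bounds hn <;> nlinarith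

lemma not_dvd_mul {m n j : ℤ} (hco : IsCoprime m n) (h0 : 0 < j) (h1 : j < n) : ¬ n ∣ m * j := by
  intro h
  have := Int.le_of_dvd h0 (hco.symm.dvd_of_dvd_mul_left h)
  omega

lemma map_range_add_two {α : Type*} (f : ℕ → α) (k l : ℕ) :
    (List.range (k + 2 + l)).map f = (List.range k).map f ++ [f k, f (k + 1)] ++
      (List.range l).map fun i => f (k + 2 + i) := by
  rw [List.range_add, List.map_append, List.range_succ, List.range_succ]
  simp [Function.comp_def]

lemma map_range_succ_succ {α : Type*} (f : ℕ → α) (k : ℕ) :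
    (List.range (k + 2)).map f = [f 0] ++ ((List.range k).map fun i => f (i + 1)) ++ [f (k + 1)] := by
  rw [List.range_succ, List.range_succ_eq_map]
  simp [Function.comp_def]

/-- The central word of the fraction `m / n`. -/
def centralWord (m : ℤ) (n : ℕ) : List ℤ := (List.range (n - 2)).map (mech m n m)

lemma length_centralWord (m : ℤ) (n : ℕ) : (centralWord m n).length = n - 2 := by
  simp [centralWord]

lemma mech_add_period {m : ℤ} {n : ℕ} (hn : 0 < n) (r : ℤ) (i : ℕ) :
    mech m n r (n + i) = mech m n r i := by
  have hn' : (n : ℤ) ≠ 0 := by omega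
  simp only [mech]
  push_cast
  have h1 : m * (n + i + 1) + r = (m * (i + 1) + r) + n * m := by ring
  have h2 : m * (n + i) + r = (m * i + r) + n * m := by ring
  rw [h1, h2, Int.add_mul_ediv_left _ _ hn', Int.add_mul_ediv_left _ _ hn']
  ring

lemma mech_mod {m : ℤ} {n : ℕ} (hn : 0 < n) (r : ℤ) (i : ℕ) :
    mech m n r (i % n) = mech m n r i := by
  induction i using Nat.strong_induction_on with
  | _ i ih =>
    rcases lt_or_ge i n with h | h
    · rw [Nat.mod_eq_of_lt h]
    · obtain ⟨j, rfl⟩ := Nat.exists_eq_add_of_le h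
      rw [mech_add_period hn, Nat.add_mod_left]
      exact ih j (by omega)

lemma omegaPower_map_mech {m : ℤ} {n : ℕ} (hn : 0 < n) (r : ℤ) :
    omegaPower ((List.range n).map (mech m n r)) = mech m n r := by
  funext i
  have h : i % n < n := Nat.mod_lt _ hn
  rw [← mech_mod hn r i]
  simp [omegaPower, List.getD_eq_getElem?_getD, h]

lemma lowerMechanical_eq (m n : ℕ) : lowerMechanical ((m : ℝ) / n) 0 = mech m n 0 := by
  have key : ∀ j : ℤ, ⌊(m : ℝ) / n * j + 0⌋ = (m * j + 0 : ℤ) / (n : ℤ) := by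
    intro j
    have : (m : ℝ) / n * j + 0 = ((m * j : ℤ) : ℝ) / (n : ℕ) := by push_cast; ring
    rw [this, Int.floor_div_natCast, Int.floor_intCast, add_zero]
  funext i
  have h1 := key (i + 1)
  have h2 := key i
  push_cast at h1 h2
  rw [lowerMechanical, mech, h1, h2]

lemma upperMechanical_eq {m n : ℕ} (hn : 0 < n) :
    upperMechanical ((m : ℝ) / n) 0 = mech m n (-1) := by
  have hn' : (0 : ℤ) < n := by omega
  have key : ∀ j : ℤ, ⌈(m : ℝ) / n * j + 0⌉ = (m * j + -1 : ℤ) / (n : ℤ) + 1 := by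
    intro j
    have : (m : ℝ) / n * j + 0 = - (((-(m * j) : ℤ) : ℝ) / (n : ℕ)) := by push_cast; ring
    rw [this, Int.ceil_neg, Int.floor_div_natCast, Int.floor_intCast]
    have h1 := Int.mul_ediv_add_emod (-(m * j)) n
    have h2 := Int.emod_nonneg (-(m * j)) hn'.ne'
    have h3 := Int.emod_lt_of_pos (-(m * j)) hn'
    have : (m * j + -1 : ℤ) / (n : ℤ) = -((-(m * j)) / (n : ℤ)) - 1 := by
      apply ediv_eq_of_bounds hn' <;> nlinarith
    rw [this]; ring
  funext i
  have h1 := key (i + 1)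
  have h2 := key i
  push_cast at h1 h2
  rw [upperMechanical, mech, h1, h2]
  ring

lemma lowerChristoffel_eq (m n : ℕ) : lowerChristoffel m n = (List.range n).map (mech m n 0) := by
  rw [lowerChristoffel, lowerMechanical_eq]

lemma upperChristoffel_eq {m n : ℕ} (hn : 0 < n) :
    upperChristoffel m n = (List.range n).map (mech m n (-1)) := by
  rw [upperChristoffel, upperMechanical_eq hn]

/-- `m / n` is a noninteger fraction in lowest terms with integer part `a`. -/
structure Slope (a m : ℤ) (n : ℕ) : Prop where
  two_le : 2 ≤ n
  coprime : IsCoprime m n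
  div_eq : m / n = a

namespace Slope

variable {a m : ℤ} {n : ℕ}

lemma not_dvd (h : Slope a m n) {j : ℤ} (h0 : 0 < j) (h1 : j < n) : ¬ (n : ℤ) ∣ m * j :=
  not_dvd_mul h.coprime h0 h1

lemma pos (h : Slope a m n) : (0 : ℤ) < n := by have := h.two_le; omega

lemma mul_sub_one_ediv (h : Slope a m n) {j : ℤ} (h0 : 0 < j) (h1 : j < n) :
    (m * j - 1) / n = m * j / n :=
  sub_one_ediv h.pos (h.not_dvd h0 h1)

/-- Lowering the numerator of `m j / n` by one changes the floor only when `n ∣ m j`, which fails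
for `0 < j < n`. Hence the two bounding words share a prefix of length `n - 2`, the central word. -/
lemma mech_sub_one (h : Slope a m n) {i : ℕ} (hi : i + 2 < n) :
    mech m n (m - 1) i = mech m n m i := by
  have h1 := h.mul_sub_one_ediv (j := i + 2) (by omega) (by omega)
  have h2 := h.mul_sub_one_ediv (j := i + 1) (by omega) (by omega)
  have e1 : m * (i + 1) + (m - 1) = m * (i + 2) - 1 := by ring
  have e2 : m * i + (m - 1) = m * (i + 1) - 1 := by ring
  have e3 : m * (i + 1) + m = m * (i + 2) := by ring
  have e4 : m * i + m = m * (i + 1) := by ring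
  rw [mech, mech, e1, e2, e3, e4, h1, h2]

lemma lt_num (h : Slope a m n) : a * n < m := by
  have h1 := Int.mul_ediv_add_emod m n
  have h2 := Int.emod_nonneg m h.pos.ne'
  have h4 : m % n ≠ 0 := fun h5 => by
    have := h.not_dvd one_pos (by have := h.two_le; omega)
    rw [mul_one] at this
    exact this (Int.dvd_of_emod_eq_zero h5)
  rw [h.div_eq] at h1
  have : 0 < m % n := by omega
  linarith

lemma num_lt (h : Slope a m n) : m < (a + 1) * n := by
  have h1 := Int.mul_ediv_add_emod m n
  have h3 := Int.emod_lt_of_pos m h.pos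
  rw [h.div_eq] at h1
  linarith

lemma mk' (hn : 2 ≤ n) (hco : IsCoprime m n) (h1 : a * n ≤ m) (h2 : m < (a + 1) * n) :
    Slope a m n :=
  ⟨hn, hco, ediv_eq_of_bounds (by omega) h1 h2⟩

lemma mech_zero_zero (h : Slope a m n) : mech m n 0 0 = a := by
  simp [mech_zero, h.div_eq]

lemma mech_neg_one_zero (h : Slope a m n) : mech m n (-1) 0 = a + 1 := by
  have h1 := h.mul_sub_one_ediv one_pos (by have := h.two_le; omega)
  have h2 : (-1 : ℤ) / n = -1 := ediv_eq_of_bounds h.pos (by have := h.pos; omega) (by simp)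
  rw [mul_one, h.div_eq] at h1
  rw [mech_zero, h2, ← sub_eq_add_neg, h1]
  ring

lemma mech_zero_last (h : Slope a m n) {k : ℕ} (hk : k + 1 = n) : mech m n 0 k = a + 1 := by
  have h0 := h.lt_num
  have h1 := h.num_lt
  have e0 : (k : ℤ) = n - 1 := by omega
  have e1 : (m * (k + 1) + 0) / (n : ℤ) = m := by
    rw [e0, add_zero, sub_add_cancel]; exact Int.mul_ediv_cancel _ h.pos.ne'
  have e2 : (m * k + 0) / (n : ℤ) = m - a - 1 := by
    rw [e0]
    apply ediv_eq_of_bounds h.pos <;> linarith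
  rw [mech, e1, e2]; ring

lemma mech_neg_one_last (h : Slope a m n) {k : ℕ} (hk : k + 1 = n) : mech m n (-1) k = a := by
  have h0 := h.lt_num
  have h1 := h.num_lt
  have e0 : (k : ℤ) = n - 1 := by omega
  have hn := h.pos
  have e1 : (m * (k + 1) + -1) / (n : ℤ) = m - 1 := by
    rw [e0]
    apply ediv_eq_of_bounds h.pos <;> linarith
  have e2 : (m * k + -1) / (n : ℤ) = m - a - 1 := by
    rw [e0]
    apply ediv_eq_of_bounds h.pos <;> linarith [Int.add_one_le_iff.2 h0]
  rw [mech, e1, e2]; ring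

lemma mech_num_eq (m : ℤ) (n i : ℕ) : mech m n m i = mech m n 0 (i + 1) := by
  rw [mech_succ, zero_add]

lemma mech_num_sub_one_eq (m : ℤ) (n i : ℕ) : mech m n (m - 1) i = mech m n (-1) (i + 1) := by
  rw [mech_succ, neg_add_eq_sub]

lemma mech_num_left (h : Slope a m n) {k : ℕ} (hk : k + 2 = n) : mech m n m k = a + 1 := by
  rw [mech_num_eq, h.mech_zero_last (by omega)]

lemma mech_num_right (h : Slope a m n) {k : ℕ} (hk : k + 1 = n) : mech m n m k = a := by
  have : k + 1 = n + 0 := by omega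
  rw [mech_num_eq, this, mech_add_period (by omega), h.mech_zero_zero]

lemma mech_num_sub_one_left (h : Slope a m n) {k : ℕ} (hk : k + 2 = n) :
    mech m n (m - 1) k = a := by
  rw [mech_num_sub_one_eq, h.mech_neg_one_last (by omega)]

lemma mech_num_sub_one_right (h : Slope a m n) {k : ℕ} (hk : k + 1 = n) :
    mech m n (m - 1) k = a + 1 := by
  have : k + 1 = n + 0 := by omega
  rw [mech_num_sub_one_eq, this, mech_add_period (by omega), h.mech_neg_one_zero]

lemma centralWord_eq (h : Slope a m n) :
    centralWord m n = (List.range (n - 2)).map (mech m n (m - 1)) :=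
  List.map_congr_left fun i hi => (h.mech_sub_one (by rw [List.mem_range] at hi; omega)).symm

lemma lower_eq (h : Slope a m n) :
    (List.range n).map (mech m n 0) = [a] ++ centralWord m n ++ [a + 1] := by
  obtain ⟨k, rfl⟩ := Nat.exists_eq_add_of_le' h.two_le
  rw [map_range_succ_succ, h.mech_zero_zero, h.mech_zero_last rfl]
  simp only [centralWord, funext (mech_num_eq m (k + 2)), Nat.add_sub_cancel]

lemma upper_eq (h : Slope a m n) :
    (List.range n).map (mech m n (-1)) = [a + 1] ++ centralWord m n ++ [a] := by
  rw [h.centralWord_eq]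
  obtain ⟨k, rfl⟩ := Nat.exists_eq_add_of_le' h.two_le
  rw [map_range_succ_succ, h.mech_neg_one_zero, h.mech_neg_one_last rfl]
  simp only [funext (mech_num_sub_one_eq m (k + 2)), Nat.add_sub_cancel]

lemma append_high_low (h : Slope a m n) :
    (List.range n).map (mech m n m) = centralWord m n ++ [a + 1, a] := by
  obtain ⟨k, rfl⟩ := Nat.exists_eq_add_of_le' h.two_le
  have := map_range_add_two (mech m (k + 2 : ℕ) m) k 0
  rw [h.mech_num_left rfl, h.mech_num_right rfl] at this
  simpa [centralWord] using this

lemma append_low_high (h : Slope a m n) :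
    (List.range n).map (mech m n (m - 1)) = centralWord m n ++ [a, a + 1] := by
  rw [h.centralWord_eq]
  obtain ⟨k, rfl⟩ := Nat.exists_eq_add_of_le' h.two_le
  have := map_range_add_two (mech m (k + 2 : ℕ) (m - 1)) k 0
  rw [h.mech_num_sub_one_left rfl, h.mech_num_sub_one_right rfl] at this
  simpa using this

end Slope

lemma isCentral_iff {a : ℤ} (ha : 0 ≤ a) {z : List ℤ} :
    IsCentral a (a + 1) z ↔ ∃ (m : ℤ) (n : ℕ), Slope a m n ∧ z = centralWord m n := by
  constructor
  · rintro ⟨m, n, hn, hco, h1, h2⟩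
    rw [lowerChristoffel_eq] at h1
    have hlen : n = z.length + 2 := by simpa using congrArg List.length h1
    have hS : Slope a m n := by
      refine ⟨by omega, by exact_mod_cast Nat.isCoprime_iff_coprime.2 hco, ?_⟩
      rw [hlen, map_range_succ_succ, ← hlen] at h1
      simp only [List.cons_append, List.nil_append, List.cons.injEq] at h1
      simpa [mech_zero] using h1.1
    refine ⟨m, n, hS, ?_⟩
    rw [hS.lower_eq] at h1
    simpa using h1.symm
  · rintro ⟨m, n, hS, rfl⟩
    have h1 := hS.lt_num
    have h2 : 0 ≤ a * n := mul_nonneg ha hS.pos.le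
    obtain ⟨M, rfl⟩ := Int.eq_ofNat_of_zero_le (by omega : 0 ≤ m)
    have hn : 0 < n := by have := hS.two_le; omega
    exact ⟨M, n, hn, Nat.isCoprime_iff_coprime.1 hS.coprime,
      by rw [lowerChristoffel_eq]; exact hS.lower_eq, by rw [upperChristoffel_eq hn]; exact hS.upper_eq⟩

/-! ### Farey neighbours -/

section Mediant

variable {a m₁ m₂ : ℤ} {n₁ n₂ : ℕ}

/-- The mediant exceeds `m₂ / n₂` by `1 / (n₂ (n₁ + n₂))`. After multiplication by `j` the excess is
less than `1 / n₂`, too little to carry a multiple of `1 / n₂` to the next integer. -/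
lemma mediant_ediv (hn₁ : 0 < n₁) (hn₂ : 0 < n₂) (hdet : m₁ * n₂ - m₂ * n₁ = 1) {j : ℤ}
    (h0 : 0 ≤ j) (h1 : j < n₁ + n₂) :
    (m₁ + m₂) * j / ((n₁ + n₂ : ℕ) : ℤ) = m₂ * j / n₂ := by
  have p₁ : (0 : ℤ) < n₁ := by omega
  have p₂ : (0 : ℤ) < n₂ := by omega
  have e1 := Int.mul_ediv_add_emod (m₂ * j) n₂
  have e2 := Int.emod_nonneg (m₂ * j) p₂.ne'
  have e3 := Int.emod_lt_of_pos (m₂ * j) p₂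
  set F := m₂ * j / (n₂ : ℤ)
  set ρ := m₂ * j % (n₂ : ℤ)
  have k1 : n₂ * (m₁ * j - F * n₁) = j + n₁ * ρ := by
    linear_combination j * hdet - n₁ * e1
  have k2 : 0 ≤ m₁ * j - F * n₁ := by
    by_contra h
    have : 0 ≤ (n₁ : ℤ) * ρ := by positivity
    nlinarith
  have k3 : (n₂ : ℤ) * ((F + 1) * n₁ - m₁ * j) = n₁ * (n₂ - ρ) - j := by
    linear_combination - k1
  have k4 : 0 ≤ (F + 1) * n₁ - m₁ * j := by
    by_contra h
    have : (n₁ : ℤ) * 1 ≤ n₁ * (n₂ - ρ) := by gcongr; omega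
    nlinarith
  apply ediv_eq_of_bounds
  · push_cast; omega
  · push_cast; nlinarith
  · push_cast; nlinarith

/-- The same from the other neighbour: the mediant is below `m₁ / n₁`, and `(x - 1) / n` is the
ceiling of the fraction `x / n` minus one. -/
lemma mediant_sub_one_ediv (hn₁ : 0 < n₁) (hn₂ : 0 < n₂) (hdet : m₁ * n₂ - m₂ * n₁ = 1) {j : ℤ}
    (h0 : 0 ≤ j) (h1 : j < n₁ + n₂) :
    ((m₁ + m₂) * j - 1) / ((n₁ + n₂ : ℕ) : ℤ) = (m₁ * j - 1) / n₁ := by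
  have p₁ : (0 : ℤ) < n₁ := by omega
  have p₂ : (0 : ℤ) < n₂ := by omega
  have e1 := Int.mul_ediv_add_emod (m₁ * j - 1) n₁
  have e2 := Int.emod_nonneg (m₁ * j - 1) p₁.ne'
  have e3 := Int.emod_lt_of_pos (m₁ * j - 1) p₁
  set F := (m₁ * j - 1) / (n₁ : ℤ)
  set ρ := (m₁ * j - 1) % (n₁ : ℤ)
  have k1 : (n₁ : ℤ) * (m₂ * j - F * n₂) = n₂ * (ρ + 1) - j := by
    linear_combination - j * hdet - n₂ * e1
  have k2 : 0 ≤ m₂ * j - F * n₂ := by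
    by_contra h
    have : (n₂ : ℤ) * 1 ≤ n₂ * (ρ + 1) := by gcongr; omega
    nlinarith
  have k4 : 0 ≤ (F + 1) * n₂ - m₂ * j := by
    by_contra h
    have : 0 ≤ (n₂ : ℤ) * (n₁ - 1 - ρ) := by
      have : 0 ≤ n₁ - 1 - ρ := by omega
      positivity
    nlinarith
  apply ediv_eq_of_bounds
  · push_cast; omega
  · push_cast; nlinarith
  · push_cast; nlinarith

lemma mediant_slope (h₁ : Slope a m₁ n₁) (h₂ : Slope a m₂ n₂) (hdet : m₁ * n₂ - m₂ * n₁ = 1) :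
    Slope a (m₁ + m₂) (n₁ + n₂) := by
  have q₁ := h₁.two_le
  have q₂ := h₂.two_le
  refine ⟨by omega, ⟨n₂, -m₂, by push_cast; linear_combination hdet⟩, ?_⟩
  have := mediant_ediv (j := 1) (by omega) (by omega) hdet (by omega) (by omega)
  rw [mul_one, mul_one, h₂.div_eq] at this
  exact this

lemma mediant_mech (h₁ : Slope a m₁ n₁) (h₂ : Slope a m₂ n₂) (hdet : m₁ * n₂ - m₂ * n₁ = 1)
    {i : ℕ} (hi : i + 2 < n₁ + n₂) :
    mech (m₁ + m₂) (n₁ + n₂ : ℕ) (m₁ + m₂) i = mech m₂ n₂ m₂ i := by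
  have q₁ := h₁.two_le
  have q₂ := h₂.two_le
  have e1 := mediant_ediv (j := i + 2) (by omega) (by omega) hdet (by omega) (by omega)
  have e2 := mediant_ediv (j := i + 1) (by omega) (by omega) hdet (by omega) (by omega)
  have e3 : (m₁ + m₂) * (i + 1) + (m₁ + m₂) = (m₁ + m₂) * (i + 2) := by ring
  have e4 : (m₁ + m₂) * i + (m₁ + m₂) = (m₁ + m₂) * (i + 1) := by ring
  have e5 : m₂ * (i + 1) + m₂ = m₂ * (i + 2) := by ring
  have e6 : m₂ * i + m₂ = m₂ * (i + 1) := by ring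
  rw [mech, mech, e3, e4, e5, e6, e1, e2]

lemma mediant_mech_sub_one (h₁ : Slope a m₁ n₁) (h₂ : Slope a m₂ n₂)
    (hdet : m₁ * n₂ - m₂ * n₁ = 1) {i : ℕ} (hi : i + 2 < n₁ + n₂) :
    mech (m₁ + m₂) (n₁ + n₂ : ℕ) (m₁ + m₂) i = mech m₁ n₁ (m₁ - 1) i := by
  have q₁ := h₁.two_le
  have q₂ := h₂.two_le
  rw [← (mediant_slope h₁ h₂ hdet).mech_sub_one hi]
  have e1 := mediant_sub_one_ediv (j := i + 2) (by omega) (by omega) hdet (by omega) (by omega)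
  have e2 := mediant_sub_one_ediv (j := i + 1) (by omega) (by omega) hdet (by omega) (by omega)
  have e3 : (m₁ + m₂) * (i + 1) + (m₁ + m₂ - 1) = (m₁ + m₂) * (i + 2) - 1 := by ring
  have e4 : (m₁ + m₂) * i + (m₁ + m₂ - 1) = (m₁ + m₂) * (i + 1) - 1 := by ring
  have e5 : m₁ * (i + 1) + (m₁ - 1) = m₁ * (i + 2) - 1 := by ring
  have e6 : m₁ * i + (m₁ - 1) = m₁ * (i + 1) - 1 := by ring
  rw [mech, mech, e3, e4, e5, e6, e1, e2]

lemma mediant_centralWord_high_low (h₁ : Slope a m₁ n₁) (h₂ : Slope a m₂ n₂)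
    (hdet : m₁ * n₂ - m₂ * n₁ = 1) :
    centralWord (m₁ + m₂) (n₁ + n₂) = centralWord m₂ n₂ ++ [a + 1, a] ++ centralWord m₁ n₁ := by
  have q₁ := h₁.two_le
  have q₂ := h₂.two_le
  have e : n₁ + n₂ - 2 = (n₂ - 2) + 2 + (n₁ - 2) := by omega
  rw [centralWord, e, map_range_add_two, mediant_mech h₁ h₂ hdet (by omega),
    mediant_mech h₁ h₂ hdet (by omega), h₂.mech_num_left (by omega), h₂.mech_num_right (by omega)]
  congr 1
  · congr 1
    exact List.map_congr_left fun i hi => mediant_mech h₁ h₂ hdet (by rw [List.mem_range] at hi; omega)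
  · refine List.map_congr_left fun i hi => ?_
    rw [List.mem_range] at hi
    rw [mediant_mech h₁ h₂ hdet (by omega)]
    have : n₂ - 2 + 2 + i = n₂ + i := by omega
    -- The period `n₂` carries position `n₂ + i` back to `i`, where the mediant word also agrees
    -- with that of `m₁ / n₁`.
    rw [this, mech_add_period (by omega), ← mediant_mech h₁ h₂ hdet (by omega),
      mediant_mech_sub_one h₁ h₂ hdet (by omega), h₁.mech_sub_one (by omega)]

lemma mediant_centralWord_low_high (h₁ : Slope a m₁ n₁) (h₂ : Slope a m₂ n₂)
    (hdet : m₁ * n₂ - m₂ * n₁ = 1) :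
    centralWord (m₁ + m₂) (n₁ + n₂) = centralWord m₁ n₁ ++ [a, a + 1] ++ centralWord m₂ n₂ := by
  have q₁ := h₁.two_le
  have q₂ := h₂.two_le
  have e : n₁ + n₂ - 2 = (n₁ - 2) + 2 + (n₂ - 2) := by omega
  rw [centralWord, e, map_range_add_two, mediant_mech_sub_one h₁ h₂ hdet (by omega),
    mediant_mech_sub_one h₁ h₂ hdet (by omega), h₁.mech_num_sub_one_left (by omega),
    h₁.mech_num_sub_one_right (by omega), h₁.centralWord_eq]
  congr 1
  · congr 1
    exact List.map_congr_left fun i hi =>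
      mediant_mech_sub_one h₁ h₂ hdet (by rw [List.mem_range] at hi; omega)
  · refine List.map_congr_left fun i hi => ?_
    rw [List.mem_range] at hi
    rw [mediant_mech_sub_one h₁ h₂ hdet (by omega)]
    have : n₁ - 2 + 2 + i = n₁ + i := by omega
    rw [this, mech_add_period (by omega), ← mediant_mech_sub_one h₁ h₂ hdet (by omega),
      mediant_mech h₁ h₂ hdet (by omega)]

end Mediant

/-! ### Decompositions of a central word -/

section Pairs

variable {a m m₁ m₂ : ℤ} {n n₁ n₂ : ℕ}

lemma exists_bezout (h : Slope a m n) : ∃ j i : ℤ, 0 < j ∧ j < n ∧ m * j - n * i = 1 := by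
  have hn := h.two_le
  obtain ⟨u, v, huv⟩ := h.coprime
  have e1 := Int.mul_ediv_add_emod u n
  have e2 := Int.emod_nonneg u h.pos.ne'
  have e3 := Int.emod_lt_of_pos u h.pos
  have e4 : m * (u % n) - n * (-(v + m * (u / n))) = 1 := by
    linear_combination huv + m * e1
  refine ⟨u % n, _, ?_, e3, e4⟩
  rcases e2.lt_or_eq with h1 | h1
  · exact h1
  · exfalso
    rw [← h1, mul_zero] at e4
    have : (n : ℤ) ∣ 1 := ⟨v + m * (u / n), by linarith⟩
    have := Int.le_of_dvd one_pos this
    omega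

lemma bezout_unique (h : Slope a m n) {j i j' i' : ℤ} (h0 : 0 < j) (h1 : j < n)
    (h2 : m * j - n * i = 1) (h0' : 0 < j') (h1' : j' < n) (h2' : m * j' - n * i' = 1) :
    j = j' := by
  have h3 : (n : ℤ) ∣ m * (j - j') := ⟨i - i', by linear_combination h2 - h2'⟩
  have h4 := h.coprime.symm.dvd_of_dvd_mul_left h3
  have h5 := Int.eq_zero_of_abs_lt_dvd h4 (by rw [abs_lt]; constructor <;> omega)
  omega

/-- A triangle spanned by the steps of three central words contains no further lattice point. -/
lemma det_eq_one_of_floors (h : Slope a (m₁ + m₂) (n₁ + n₂)) (h₁ : Slope a m₁ n₁)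
    (h₂ : Slope a m₂ n₂)
    (hF₂ : ∀ j : ℤ, 0 < j → j < n₂ → (m₁ + m₂) * j / (n₁ + n₂ : ℕ) = m₂ * j / n₂)
    (hF : (m₁ + m₂) * n₂ / (n₁ + n₂ : ℕ) = m₂)
    (hF₁ : ∀ j : ℤ, 0 < j → j < n₁ → (m₁ + m₂) * (n₂ + j) / (n₁ + n₂ : ℕ) = m₂ + m₁ * j / n₁) :
    m₁ * n₂ - m₂ * n₁ = 1 := by
  have hn := h.pos
  have hn₁ := h₁.pos
  have hn₂ := h₂.pos
  have he1 : 0 < m₁ * n₂ - m₂ * n₁ := by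
    have k1 := Int.mul_ediv_add_emod ((m₁ + m₂) * n₂) (n₁ + n₂ : ℕ)
    have k2 := Int.emod_nonneg ((m₁ + m₂) * n₂) hn.ne'
    have k3 : (m₁ + m₂) * n₂ % (n₁ + n₂ : ℕ) ≠ 0 := fun k =>
      h.not_dvd hn₂ (by push_cast; omega) (Int.dvd_of_emod_eq_zero k)
    rw [hF] at k1
    have : 0 < (m₁ + m₂) * n₂ % (n₁ + n₂ : ℕ) := by omega
    push_cast at k1
    push_cast at this
    linarith
  obtain ⟨j, i, hj0, hj1, hji⟩ := exists_bezout h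
  have hfl : (m₁ + m₂) * j / (n₁ + n₂ : ℕ) = i := by
    have := h.two_le
    apply ediv_eq_of_bounds hn
    · linarith
    · have : (2 : ℤ) ≤ (n₁ + n₂ : ℕ) := by exact_mod_cast this
      linarith
  rcases lt_trichotomy j n₂ with hlt | heq | hgt
  · exfalso
    have k1 := hF₂ j hj0 hlt
    rw [hfl] at k1
    have k2 : i * n₂ ≤ m₂ * j := by rw [k1]; exact Int.ediv_mul_le _ hn₂.ne'
    -- Reflecting `(j, i)` in the midpoint of the segment from `0` to `(n₂, m₂)` gives a point that
    -- is also below the long line, since `(n₂, m₂)` is no closer to it than `(j, i)`. Both points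
    -- are then below the segment, so both lie on it, against coprimality.
    have k3 : m₂ - i ≤ (m₁ + m₂) * (n₂ - j) / (n₁ + n₂ : ℕ) := by
      rw [Int.le_ediv_iff_mul_le hn]
      push_cast at hji ⊢
      linarith
    rw [hF₂ _ (by omega) (by omega), Int.le_ediv_iff_mul_le hn₂] at k3
    have k4 : m₂ * j = n₂ * i := by linarith
    exact h₂.not_dvd hj0 hlt ⟨i, k4⟩
  · subst heq
    have : i = m₂ := by rw [← hfl, hF]
    rw [this] at hji
    push_cast at hji
    linarith
  · exfalso
    have hj2 : j < n₁ + n₂ := by exact_mod_cast hj1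
    have k1 := hF₁ (j - n₂) (by omega) (by omega)
    rw [add_sub_cancel, hfl] at k1
    have k2 : (i - m₂) * n₁ ≤ m₁ * (j - n₂) := by
      have : i - m₂ = m₁ * (j - n₂) / n₁ := by omega
      rw [this]; exact Int.ediv_mul_le _ hn₁.ne'
    -- The same reflection on the segment from `(n₂, m₂)` to the end of the long line.
    have k3 : m₂ + (m₁ - (i - m₂)) ≤ (m₁ + m₂) * (n₂ + (n₁ - (j - n₂))) / (n₁ + n₂ : ℕ) := by
      rw [Int.le_ediv_iff_mul_le hn]
      push_cast at hji ⊢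
      linarith
    rw [hF₁ _ (by omega) (by omega), add_le_add_iff_left, Int.le_ediv_iff_mul_le hn₁] at k3
    have k4 : m₁ * (j - n₂) = n₁ * (i - m₂) := by linarith
    exact h₁.not_dvd (by omega) (by omega) ⟨_, k4⟩

lemma sum_mech_num (h : Slope a m n) (N : ℕ) :
    ∑ i ∈ Finset.range N, mech m n m i = m * (N + 1 : ℤ) / n - a := by
  rw [sum_mech, h.div_eq]; congr 2; ring

/-- Letters determine prefix sums, which are floors of multiples of the slopes, so the factorization
becomes the floor equations of `det_eq_one_of_floors`. -/
lemma det_eq_one_of_centralWord (h : Slope a m n) (h₁ : Slope a m₁ n₁) (h₂ : Slope a m₂ n₂)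
    (hu : centralWord m n = centralWord m₂ n₂ ++ [a + 1, a] ++ centralWord m₁ n₁) :
    m = m₁ + m₂ ∧ n = n₁ + n₂ ∧ m₁ * n₂ - m₂ * n₁ = 1 := by
  have q := h.two_le
  have q₁ := h₁.two_le
  have q₂ := h₂.two_le
  have hn : n = n₁ + n₂ := by
    have := congrArg List.length hu
    simp only [length_centralWord, List.length_append, List.length_cons, List.length_nil] at this
    omega
  have e : n - 2 = (n₂ - 2) + 2 + (n₁ - 2) := by omega
  rw [centralWord, e, map_range_add_two] at hu
  obtain ⟨hu', hu1⟩ := List.append_inj hu (by simp [length_centralWord])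
  obtain ⟨hu2, hu3⟩ := List.append_inj hu' (by simp [length_centralWord])
  simp only [List.cons.injEq, and_true] at hu3
  obtain ⟨l2, l3⟩ := hu3
  have l1 : ∀ i < n₂ - 2, mech m n m i = mech m₂ n₂ m₂ i := fun i hi =>
    List.map_inj_left.1 hu2 i (List.mem_range.2 hi)
  have l4 : ∀ i < n₁ - 2, mech m n m (n₂ + i) = mech m₁ n₁ m₁ i := fun i hi => by
    have := List.map_inj_left.1 hu1 i (List.mem_range.2 hi)
    rwa [show n₂ - 2 + 2 + i = n₂ + i by omega] at this
  have g2 : ∀ N ≤ n₂ - 2, m * (N + 1 : ℤ) / n = m₂ * (N + 1 : ℤ) / n₂ := fun N hN => by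
    have k1 := sum_mech_num h N
    have k2 := sum_mech_num h₂ N
    have k3 : ∑ i ∈ Finset.range N, mech m n m i = ∑ i ∈ Finset.range N, mech m₂ n₂ m₂ i :=
      Finset.sum_congr rfl fun i hi => l1 i (by rw [Finset.mem_range] at hi; omega)
    omega
  -- The floor at `n' - 1` contains the numerator explicitly; this recovers `m₂` and `m = m₁ + m₂`
  -- from the letters.
  have last : ∀ {m' : ℤ} {n' : ℕ}, Slope a m' n' → m' * ((n' - 2 : ℕ) + 1 : ℤ) / n' = m' - a - 1 := by
    intro m' n' h'
    have := h'.two_le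
    have t1 := h'.lt_num
    have t2 := h'.num_lt
    have : ((n' - 2 : ℕ) + 1 : ℤ) = n' - 1 := by omega
    rw [this]
    apply ediv_eq_of_bounds h'.pos <;> linarith
  have gm : m * n₂ / n = m₂ := by
    have k1 := sum_mech_num h (n₂ - 2 + 1)
    have k2 := sum_mech_num h (n₂ - 2)
    rw [Finset.sum_range_succ, l2] at k1
    have k3 := g2 (n₂ - 2) le_rfl
    have k4 := last h₂
    have k5 : (((n₂ - 2 + 1 : ℕ) : ℤ) + 1) = n₂ := by omega
    rw [k5] at k1
    omega
  have g1 : ∀ N ≤ n₁ - 2, m * (n₂ + (N + 1) : ℤ) / n = m₂ + m₁ * (N + 1 : ℤ) / n₁ := fun N hN => by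
    have k1 := sum_mech_num h (n₂ + N)
    have k2 := sum_mech_num h₁ N
    have k3 := sum_mech_num h (n₂ - 2 + 1)
    have k5 : (((n₂ - 2 + 1 : ℕ) : ℤ) + 1) = n₂ := by omega
    rw [k5, gm] at k3
    have k6 : n₂ = n₂ - 2 + 1 + 1 := by omega
    have k7 : ∑ i ∈ Finset.range n₂, mech m n m i = m₂ := by
      rw [k6, Finset.sum_range_succ, k3, l3]; ring
    rw [Finset.sum_range_add, k7, Finset.sum_congr rfl fun i hi =>
      l4 i (by rw [Finset.mem_range] at hi; omega), k2] at k1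
    have k8 : ((n₂ + N : ℕ) : ℤ) + 1 = n₂ + (N + 1) := by push_cast; ring
    rw [k8] at k1
    omega
  have hm : m = m₁ + m₂ := by
    have k1 := g1 (n₁ - 2) le_rfl
    rw [last h₁] at k1
    have k2 := last h
    have : (n₂ + ((n₁ - 2 : ℕ) + 1) : ℤ) = ((n - 2 : ℕ) + 1 : ℤ) := by omega
    rw [this, k2] at k1
    omega
  refine ⟨hm, hn, ?_⟩
  subst hm hn
  refine det_eq_one_of_floors h h₁ h₂ (fun j hj0 hj1 => ?_) gm (fun j hj0 hj1 => ?_)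
  · obtain ⟨N, rfl⟩ : ∃ N : ℕ, j = N + 1 := ⟨(j - 1).toNat, by omega⟩
    exact g2 N (by omega)
  · obtain ⟨N, rfl⟩ : ∃ N : ℕ, j = N + 1 := ⟨(j - 1).toNat, by omega⟩
    exact g1 N (by omega)

end Pairs

/-! ### Powers of a letter, extensions and the classification of central words -/

lemma centralWord_left (a : ℤ) (k : ℕ) :
    Slope a (a * (k + 2) + 1) (k + 2) ∧ centralWord (a * (k + 2) + 1) (k + 2) = List.replicate k a := by
  have h : Slope a (a * (k + 2) + 1) (k + 2) := by
    apply Slope.mk' (by omega) ⟨1, -a, by push_cast; ring⟩ <;> push_cast <;> linarith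
  refine ⟨h, ?_⟩
  rw [List.eq_replicate_iff]
  refine ⟨by simp [length_centralWord], fun x hx => ?_⟩
  obtain ⟨i, hi, rfl⟩ := List.mem_map.1 hx
  rw [List.mem_range] at hi
  have key : ∀ j : ℤ, 0 ≤ j → j < k + 2 → (a * (k + 2) + 1) * j / ((k + 2 : ℕ) : ℤ) = a * j := by
    intro j h0 h1
    apply ediv_eq_of_bounds h.pos <;> push_cast <;> nlinarith
  have h1 := key (i + 2) (by omega) (by omega)
  have h2 := key (i + 1) (by omega) (by omega)
  have e1 : ∀ M : ℤ, M * (i + 1) + M = M * (i + 2) := fun M => by ring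
  have e2 : ∀ M : ℤ, M * i + M = M * (i + 1) := fun M => by ring
  rw [mech, e1, e2, h1, h2]
  ring

lemma centralWord_right (a : ℤ) (k : ℕ) :
    Slope a ((a + 1) * (k + 2) - 1) (k + 2) ∧
      centralWord ((a + 1) * (k + 2) - 1) (k + 2) = List.replicate k (a + 1) := by
  have h : Slope a ((a + 1) * (k + 2) - 1) (k + 2) := by
    apply Slope.mk' (by omega) ⟨-1, a + 1, by push_cast; ring⟩ <;> push_cast <;> linarith
  refine ⟨h, ?_⟩
  rw [List.eq_replicate_iff]
  refine ⟨by simp [length_centralWord], fun x hx => ?_⟩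
  obtain ⟨i, hi, rfl⟩ := List.mem_map.1 hx
  rw [List.mem_range] at hi
  have key : ∀ j : ℤ, 0 < j → j < k + 2 →
      ((a + 1) * (k + 2) - 1) * j / ((k + 2 : ℕ) : ℤ) = (a + 1) * j - 1 := by
    intro j h0 h1
    apply ediv_eq_of_bounds h.pos <;> push_cast <;> nlinarith
  have h1 := key (i + 2) (by omega) (by omega)
  have h2 := key (i + 1) (by omega) (by omega)
  have e1 : ∀ M : ℤ, M * (i + 1) + M = M * (i + 2) := fun M => by ring
  have e2 : ∀ M : ℤ, M * i + M = M * (i + 1) := fun M => by ring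
  rw [mech, e1, e2, h1, h2]
  ring

lemma isCentral_replicate_left {a : ℤ} (ha : 0 ≤ a) (k : ℕ) : IsCentral a (a + 1) (List.replicate k a) :=
  (isCentral_iff ha).2 ⟨_, _, (centralWord_left a k).1, (centralWord_left a k).2.symm⟩

lemma isCentral_replicate_right {a : ℤ} (ha : 0 ≤ a) (k : ℕ) : IsCentral a (a + 1) (List.replicate k (a + 1)) :=
  (isCentral_iff ha).2 ⟨_, _, (centralWord_right a k).1, (centralWord_right a k).2.symm⟩

/-- Mediant of the slopes of two consecutive powers of `a`. It excludes `v = b a^k` after a longest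
central prefix `a^k`. -/
lemma isCentral_left_middle {a : ℤ} (ha : 0 ≤ a) (k : ℕ) : IsCentral a (a + 1)
    (List.replicate (k + 1) a ++ ([a + 1] ++ List.replicate (k + 1) a)) := by
  obtain ⟨h₁, e₁⟩ := centralWord_left a k
  obtain ⟨h₂, e₂⟩ := centralWord_left a (k + 1)
  have hdet : (a * (k + 2) + 1) * ((k + 1 + 2 : ℕ) : ℤ) -
      (a * ((k + 1 : ℕ) + 2) + 1) * ((k + 2 : ℕ) : ℤ) = 1 := by push_cast; ring
  refine (isCentral_iff ha).2 ⟨_, _, mediant_slope h₁ h₂ hdet, ?_⟩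
  rw [mediant_centralWord_high_low h₁ h₂ hdet, e₁, e₂]
  simp [List.replicate_succ]

lemma isCentral_right_middle {a : ℤ} (ha : 0 ≤ a) (k : ℕ) : IsCentral a (a + 1)
    (List.replicate (k + 1) (a + 1) ++ ([a] ++ List.replicate (k + 1) (a + 1))) := by
  obtain ⟨h₂, e₂⟩ := centralWord_right a k
  obtain ⟨h₁, e₁⟩ := centralWord_right a (k + 1)
  have hdet : ((a + 1) * ((k + 1 : ℕ) + 2) - 1) * ((k + 2 : ℕ) : ℤ) -
      ((a + 1) * (k + 2) - 1) * ((k + 1 + 2 : ℕ) : ℤ) = 1 := by push_cast; ring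
  refine (isCentral_iff ha).2 ⟨_, _, mediant_slope h₁ h₂ hdet, ?_⟩
  rw [mediant_centralWord_low_high h₁ h₂ hdet, e₁, e₂]
  simp [List.replicate_succ]

/-- The central words `u a b q` and `u b a p` that extend `u = p a b q = q b a p`. -/
lemma isCentral_extend {a : ℤ} (ha : 0 ≤ a) {u p q : List ℤ} (hu : IsCentral a (a + 1) u)
    (hpq : IsCentralPair a (a + 1) u p q) :
    IsCentral a (a + 1) (u ++ [a, a + 1] ++ q) ∧ IsCentral a (a + 1) (u ++ [a + 1, a] ++ p) := by
  obtain ⟨hp, hq, -, e2⟩ := hpq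
  obtain ⟨m, n, h, rfl⟩ := (isCentral_iff ha).1 hu
  obtain ⟨m₁, n₁, h₁, rfl⟩ := (isCentral_iff ha).1 hp
  obtain ⟨m₂, n₂, h₂, rfl⟩ := (isCentral_iff ha).1 hq
  obtain ⟨rfl, rfl, hdet⟩ := det_eq_one_of_centralWord h h₁ h₂ e2
  have d1 : (m₁ + m₂) * (n₂ : ℤ) - m₂ * ((n₁ + n₂ : ℕ) : ℤ) = 1 := by
    push_cast; linear_combination hdet
  have d2 : m₁ * ((n₁ + n₂ : ℕ) : ℤ) - (m₁ + m₂) * (n₁ : ℤ) = 1 := by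
    push_cast; linear_combination hdet
  exact ⟨(isCentral_iff ha).2 ⟨_, _, mediant_slope h h₂ d1, (mediant_centralWord_low_high h h₂ d1).symm⟩,
    (isCentral_iff ha).2 ⟨_, _, mediant_slope h₁ h d2, (mediant_centralWord_high_low h₁ h d2).symm⟩⟩

/-- The determinant condition makes `n₂` the inverse of `m` modulo `n`, so the length of `q` is
forced. -/
lemma isCentralPair_unique {a : ℤ} (ha : 0 ≤ a) {u p q p' q' : List ℤ} (hu : IsCentral a (a + 1) u)
    (h : IsCentralPair a (a + 1) u p q) (h' : IsCentralPair a (a + 1) u p' q') :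
    p = p' ∧ q = q' := by
  obtain ⟨hp, hq, -, e⟩ := h
  obtain ⟨hp', hq', -, e'⟩ := h'
  have key : q.length = q'.length := by
    obtain ⟨m, n, h, rfl⟩ := (isCentral_iff ha).1 hu
    obtain ⟨m₁, n₁, h₁, rfl⟩ := (isCentral_iff ha).1 hp
    obtain ⟨m₂, n₂, h₂, rfl⟩ := (isCentral_iff ha).1 hq
    obtain ⟨m₁', n₁', h₁', rfl⟩ := (isCentral_iff ha).1 hp'
    obtain ⟨m₂', n₂', h₂', rfl⟩ := (isCentral_iff ha).1 hq'
    obtain ⟨t1, t2, t3⟩ := det_eq_one_of_centralWord h h₁ h₂ e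
    obtain ⟨t1', t2', t3'⟩ := det_eq_one_of_centralWord h h₁' h₂' e'
    have p₁ := h₁.two_le
    have p₂ := h₂.two_le
    have p₁' := h₁'.two_le
    have p₂' := h₂'.two_le
    have := bezout_unique h (j := n₂) (i := m₂) (j' := n₂') (i' := m₂') (by omega) (by omega)
      (by rw [t1, t2]; push_cast; linear_combination t3) (by omega) (by omega)
      (by rw [t1', t2']; push_cast; linear_combination t3')
    rw [length_centralWord, length_centralWord]
    omega
  rw [e] at e'
  obtain ⟨e1, e2⟩ := List.append_inj e' (by simp [key])
  exact ⟨e2, (List.append_inj e1 key).1⟩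

/-- Let `j` be the inverse of `m` modulo `n`. The values `j = 1` and `j = n - 1` give slopes `a + 1
/ n` and `a + 1 - 1 / n`, hence powers of a letter; any other `j` splits `m / n` into Farey
neighbours with denominators `n - j` and `j`, both at least 2. -/
lemma isCentral_cases {a : ℤ} (ha : 0 ≤ a) {u : List ℤ} (hu : IsCentral a (a + 1) u) :
    (∃ k, u = List.replicate k a) ∨ (∃ k, u = List.replicate k (a + 1)) ∨
      ∃ p q, IsCentralPair a (a + 1) u p q := by
  obtain ⟨m, n, h, rfl⟩ := (isCentral_iff ha).1 hu
  have hn := h.two_le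
  obtain ⟨k, rfl⟩ := Nat.exists_eq_add_of_le' hn
  obtain ⟨j, i, hj0, hj1, hji⟩ := exists_bezout h
  by_cases h1 : j = 1
  · left
    refine ⟨k, ?_⟩
    have : i = a := by
      rw [← h.div_eq]
      symm
      apply ediv_eq_of_bounds h.pos
      · rw [h1] at hji; linarith
      · rw [h1] at hji
        have : (2 : ℤ) ≤ (k + 2 : ℕ) := by omega
        linarith
    have hm : m = a * (k + 2) + 1 := by
      rw [h1, this] at hji; push_cast at hji; linarith
    rw [hm, (centralWord_left a k).2]
  by_cases h2 : j = ((k + 2 : ℕ) : ℤ) - 1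
  · right; left
    refine ⟨k, ?_⟩
    have : m - i = a + 1 := by
      have t1 := h.lt_num
      have t2 := h.num_lt
      have t3 : ((k + 2 : ℕ) : ℤ) * (m - i) = m + 1 := by rw [h2] at hji; linarith
      have t4 : (0 : ℤ) < (k + 2 : ℕ) := h.pos
      have t5 : a < m - i := by
        by_contra hc
        nlinarith
      have t6 : m - i < a + 2 := by
        by_contra hc
        have : (2 : ℤ) ≤ (k + 2 : ℕ) := by omega
        nlinarith
      omega
    have hm : m = (a + 1) * (k + 2) - 1 := by
      have : i = m - (a + 1) := by omega
      rw [h2, this] at hji; push_cast at hji; linarith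
    rw [hm, (centralWord_right a k).2]
  right; right
  obtain ⟨n₂, rfl⟩ := Int.eq_ofNat_of_zero_le hj0.le
  obtain ⟨n₁, hn₁⟩ := Nat.exists_eq_add_of_lt (by exact_mod_cast hj1 : n₂ < k + 2)
  have hsum : k + 2 = (n₁ + 1) + n₂ := by omega
  have hm : m = (m - i) + i := by ring
  have hdet : (m - i) * (n₂ : ℤ) - i * ((n₁ + 1 : ℕ) : ℤ) = 1 := by
    rw [hsum] at hji; push_cast at hji ⊢; linear_combination hji
  have c₁ : 2 ≤ n₁ + 1 := by omega
  have c₂ : 2 ≤ n₂ := by omega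
  rw [hm, hsum] at h ⊢
  have h₂ : Slope a i n₂ := by
    refine ⟨c₂, ⟨-((n₁ + 1 : ℕ) : ℤ), m - i, by linear_combination hdet⟩, ?_⟩
    have := mediant_ediv (j := 1) (by omega) (by omega) hdet (by omega) (by omega)
    rw [mul_one, mul_one, h.div_eq] at this
    exact this.symm
  have hco₁ : IsCoprime (m - i) ((n₁ + 1 : ℕ) : ℤ) := ⟨n₂, -i, by linear_combination hdet⟩
  have h₁ : Slope a (m - i) (n₁ + 1) := by
    refine ⟨c₁, hco₁, ?_⟩
    have e1 := mediant_sub_one_ediv (j := 1) (by omega) (by omega) hdet (by omega) (by omega)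
    have e2 := h.mul_sub_one_ediv (j := 1) (by omega) (by omega)
    have e3 := sub_one_ediv (x := m - i) (n := ((n₁ + 1 : ℕ) : ℤ)) (by omega) (by
      have := not_dvd_mul hco₁ (j := 1) (by omega) (by omega)
      rwa [mul_one] at this)
    rw [e2, mul_one, mul_one, h.div_eq, e3] at e1
    exact e1.symm
  exact ⟨centralWord (m - i) (n₁ + 1), centralWord i n₂, (isCentral_iff ha).2 ⟨_, _, h₁, rfl⟩,
    (isCentral_iff ha).2 ⟨_, _, h₂, rfl⟩, mediant_centralWord_low_high h₁ h₂ hdet,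
    mediant_centralWord_high_low h₁ h₂ hdet⟩

/-! ### Finite and infinite words -/

@[simp] lemma concat_nil (s : ℕ → ℤ) : concat [] s = s := by
  funext i; simp [concat]

@[simp] lemma concat_cons_zero (x : ℤ) (l : List ℤ) (s : ℕ → ℤ) : concat (x :: l) s 0 = x := by
  simp [concat]

@[simp] lemma concat_cons_succ (x : ℤ) (l : List ℤ) (s : ℕ → ℤ) (i : ℕ) :
    concat (x :: l) s (i + 1) = concat l s i := by
  simp [concat]

lemma concat_append (l l' : List ℤ) (s : ℕ → ℤ) :
    concat (l ++ l') s = concat l (concat l' s) := by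
  induction l with
  | nil => simp
  | cons x l ih =>
    funext i
    cases i with
    | zero => simp
    | succ i => simp [ih]

lemma concat_apply_lt {l : List ℤ} (s : ℕ → ℤ) {i : ℕ} (h : i < l.length) :
    concat l s i = l[i] := by
  simp [concat, h]

lemma begins_iff {w : List ℤ} {s : ℕ → ℤ} : Begins w s ↔ ∀ i (h : i < w.length), s i = w[i] := by
  constructor
  · rintro ⟨s', rfl⟩ i h
    exact concat_apply_lt s' h
  · intro h
    refine ⟨fun i => s (i + w.length), ?_⟩
    funext i
    unfold concat
    split_ifs with hi
    · exact h i hi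
    · simp only; congr 1; omega

lemma exists_concat (s : ℕ → ℤ) (N : ℕ) : ∃ v s', v.length = N ∧ s = concat v s' := by
  have : Begins ((List.range N).map s) s := begins_iff.2 fun i h => by simp
  obtain ⟨s', h⟩ := this
  exact ⟨_, s', by simp, h⟩

lemma omegaPower_eq_concat (w : List ℤ) :
    omegaPower w = concat w (omegaPower w) := by
  funext i
  unfold concat
  split_ifs with h
  · simp [omegaPower, Nat.mod_eq_of_lt h, h]
  · simp only [omegaPower]
    rw [Nat.mod_eq_sub_mod (not_lt.1 h)]

lemma omegaPower_eq_concat_two (w : List ℤ) :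
    omegaPower w = concat (w ++ w) (omegaPower w) := by
  rw [concat_append, ← omegaPower_eq_concat, ← omegaPower_eq_concat]

/-- If `u = H p` and `p` is a prefix of `u`, then `u` is a prefix of `H H H ⋯`. -/
lemma exists_omegaPower_eq_concat {H u p r : List ℤ} (hH : H ≠ []) (h1 : u = H ++ p)
    (h2 : u = p ++ r) : ∃ W, omegaPower H = concat u W := by
  have hlen : 0 < H.length := List.length_pos_iff.2 hH
  refine begins_iff.2 fun i => ?_
  induction i using Nat.strong_induction_on with
  | _ i ih =>
    intro hi
    by_cases hiH : i < H.length
    · rw [omegaPower_eq_concat H, concat_apply_lt _ hiH]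
      simp only [h1, List.getElem_append_left hiH]
    · have k1 : omegaPower H i = omegaPower H (i - H.length) := by
        simp only [omegaPower]
        rw [Nat.mod_eq_sub_mod (not_lt.1 hiH)]
      rw [k1, ih (i - H.length) (by omega) (by omega)]
      have k2 : i - H.length < p.length := by
        rw [h1, List.length_append] at hi; omega
      have k3 : u[i]'hi = p[i - H.length]'k2 := by
        simp only [h1, List.getElem_append_right (not_lt.1 hiH)]
      rw [k3]
      simp only [h2, List.getElem_append_left k2]

/-! ### Lexicographic comparisons -/

lemma lex_concat_cons_lt {x y : ℤ} (h : x < y) (l l' : List ℤ) (s s' : ℕ → ℤ) :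
    toLex (concat (x :: l) s) < toLex (concat (y :: l') s') :=
  lex_lt_iff.2 ⟨0, by simp, by simpa using h⟩

lemma lex_concat_cons {x : ℤ} {l l' : List ℤ} {s s' : ℕ → ℤ}
    (h : toLex (concat l s) < toLex (concat l' s')) :
    toLex (concat (x :: l) s) < toLex (concat (x :: l') s') :=
  toLex_lt_of_cons (by simp) (by simpa using h)

lemma lex_concat_left (l : List ℤ) {s s' : ℕ → ℤ} (h : toLex s < toLex s') :
    toLex (concat l s) < toLex (concat l s') := by
  induction l with
  | nil => simpa using h
  | cons x l ih => exact lex_concat_cons ih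

lemma lex_concat_of_lt {l l' : List ℤ} (hlen : l.length = l'.length) (h : l < l') (s s' : ℕ → ℤ) :
    toLex (concat l s) < toLex (concat l' s') := by
  induction l generalizing l' with
  | nil =>
    obtain rfl : l' = [] := List.length_eq_zero_iff.1 hlen.symm
    exact absurd h (lt_irrefl _)
  | cons x l ih =>
    obtain _ | ⟨y, l'⟩ := l'
    · simp at hlen
    · rcases List.cons_lt_cons_iff.1 h with h' | ⟨rfl, h'⟩
      · exact lex_concat_cons_lt h' _ _ _ _
      · exact lex_concat_cons (ih (by simpa using hlen) h')

lemma append_lt_append {l l' : List ℤ} (hlen : l.length = l'.length) (h : l < l') (r r' : List ℤ) :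
    l ++ r < l' ++ r' := by
  induction l generalizing l' with
  | nil =>
    obtain rfl : l' = [] := List.length_eq_zero_iff.1 hlen.symm
    exact absurd h (lt_irrefl _)
  | cons x l ih =>
    obtain _ | ⟨y, l'⟩ := l'
    · simp at hlen
    · rcases List.cons_lt_cons_iff.1 h with h' | ⟨rfl, h'⟩
      · exact List.cons_lt_cons_iff.2 (Or.inl h')
      · exact List.cons_lt_cons_iff.2 (Or.inr ⟨rfl, ih (by simpa using hlen) h'⟩)

lemma apply_zero_le_of_lex_lt {s s' : ℕ → ℤ} (h : toLex s < toLex s') : s 0 ≤ s' 0 := by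
  obtain ⟨j, hj, hlt⟩ := lex_lt_iff.1 h
  cases j with
  | zero => exact hlt.le
  | succ j => exact (hj 0 (by omega)).le

/-- A word that is smaller than `q r` and does not begin with `q` is already smaller than `q`. -/
lemma exists_split_lt {v q r : List ℤ} (hlen : q.length ≤ v.length) (hv : v < q ++ r)
    (hne : ∀ w, v ≠ q ++ w) : ∃ v₁ v₂, v = v₁ ++ v₂ ∧ v₁.length = q.length ∧ v₁ < q := by
  refine ⟨v.take q.length, v.drop q.length, (List.take_append_drop _ _).symm,
    by simp [hlen], ?_⟩
  have hl : (v.take q.length).length = q.length := by simp [hlen]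
  rcases lt_trichotomy (v.take q.length) q with h | h | h
  · exact h
  · exact absurd (by rw [← h, List.length_take, min_eq_left hlen, List.take_append_drop])
      (hne (v.drop q.length))
  · have := append_lt_append hl.symm h r (v.drop q.length)
    rw [List.take_append_drop] at this
    exact absurd hv this.asymm

lemma exists_split_gt {v q r : List ℤ} (hlen : q.length ≤ v.length) (hv : q ++ r < v)
    (hne : ∀ w, v ≠ q ++ w) : ∃ v₁ v₂, v = v₁ ++ v₂ ∧ v₁.length = q.length ∧ q < v₁ := by
  refine ⟨v.take q.length, v.drop q.length, (List.take_append_drop _ _).symm,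
    by simp [hlen], ?_⟩
  have hl : (v.take q.length).length = q.length := by simp [hlen]
  rcases lt_trichotomy (v.take q.length) q with h | h | h
  · have := append_lt_append hl h (v.drop q.length) r
    rw [List.take_append_drop] at this
    exact absurd hv this.asymm
  · exact absurd (by rw [← h, List.length_take, min_eq_left hlen, List.take_append_drop])
      (hne (v.drop q.length))
  · exact h

/-- `s` lies strictly between `(z a b)^ω` and `(z b a)^ω`. -/
def Between (a b : ℤ) (z : List ℤ) (s : ℕ → ℤ) : Prop :=
  toLex (omegaPower (z ++ [a, b])) < toLex s ∧ toLex s < toLex (omegaPower (z ++ [b, a]))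

lemma lex_concat_append_lt {l l₁ l₂ : List ℤ} (h : l₁ < l₂) (hlen : l₁.length = l₂.length)
    (s s' : ℕ → ℤ) : toLex (concat (l ++ l₁) s) < toLex (concat (l ++ l₂) s') := by
  simp only [concat_append]
  exact lex_concat_left _ (lex_concat_of_lt hlen h _ _)

lemma lex_concat_lt_of_append {l l₁ l₂ m₁ m₂ : List ℤ} (h : l₁ < l₂) (hlen : l₁.length = l₂.length)
    (s s' : ℕ → ℤ) : toLex (concat (l ++ (l₁ ++ m₁)) s) < toLex (concat (l ++ (l₂ ++ m₂)) s') := by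
  simp only [concat_append]
  exact lex_concat_left _ (lex_concat_of_lt hlen h _ _)

/-! ### Locating the word between two periodic words -/

section Cases

variable {a b : ℤ} {s : ℕ → ℤ} {u v : List ℤ} {s' : ℕ → ℤ}

lemma singleton_lt {x y : ℤ} (h : x < y) : ([x] : List ℤ) < [y] :=
  List.cons_lt_cons_iff.2 (Or.inl h)

lemma lt_omegaPower_of_split (hab : a < b) {z w : List ℤ} (hs : s = concat (z ++ ([a] ++ w)) s') :
    toLex s < toLex (omegaPower (z ++ [b, a])) := by
  rw [omegaPower_eq_concat, hs]
  exact lex_concat_lt_of_append (m₂ := [a]) (singleton_lt hab) rfl _ _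

lemma omegaPower_lt_of_split (hab : a < b) {z w : List ℤ} (hs : s = concat (z ++ ([b] ++ w)) s') :
    toLex (omegaPower (z ++ [a, b])) < toLex s := by
  rw [omegaPower_eq_concat, hs]
  exact lex_concat_lt_of_append (m₁ := [b]) (singleton_lt hab) rfl _ _

lemma between_replicate_left {k : ℕ} {c : ℤ} {v' : List ℤ} (hac : a < c)
    (hv : v = c :: v') (hlen : v.length = k + 1)
    (hs : s = concat (List.replicate k a ++ v) s') (hlt : v < [b] ++ List.replicate k a) :
    Between a b (List.replicate k a) s := by
  constructor
  · rw [omegaPower_eq_concat, hs, hv]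
    exact lex_concat_lt_of_append (m₁ := [b]) (m₂ := v') (singleton_lt hac) rfl _ _
  · rw [omegaPower_eq_concat_two, hs]
    have : (List.replicate k a ++ [b, a]) ++ (List.replicate k a ++ [b, a]) =
        List.replicate k a ++ (([b] ++ List.replicate k a) ++ [a, b, a]) := by
      have : [a] ++ List.replicate k a = List.replicate k a ++ [a] := by
        rw [← List.replicate_succ', List.singleton_append, List.replicate_succ]
      simpa using congrArg (· ++ [b, a]) this
    rw [this, ← List.append_nil v]
    exact lex_concat_lt_of_append hlt (by simp [hlen]) _ _

/-- The lower bound for the shorter power is `(a^(k+1) b)^ω`; two periods of it expose the block `b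
a^(k+1)` against which `v` is compared. -/
lemma between_replicate_left_pred (hab : a < b) {k : ℕ} (hlen : v.length = k + 2)
    (hs : s = concat (List.replicate (k + 1) a ++ v) s')
    (hlt : [b] ++ List.replicate (k + 1) a < v) :
    Between a b (List.replicate k a) s := by
  constructor
  · rw [omegaPower_eq_concat_two, hs]
    have : (List.replicate k a ++ [a, b]) ++ (List.replicate k a ++ [a, b]) =
        List.replicate (k + 1) a ++ (([b] ++ List.replicate (k + 1) a) ++ [b]) := by
      simp [List.replicate_succ']
    rw [this, ← List.append_nil v]
    exact lex_concat_lt_of_append hlt (by simp [hlen]) _ _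
  · refine lt_omegaPower_of_split hab (w := v) (s' := s') ?_
    rw [hs, List.replicate_succ']
    simp

lemma between_replicate_right {k : ℕ} {c : ℤ} {v' : List ℤ} (hcb : c < b)
    (hv : v = c :: v') (hlen : v.length = k + 1)
    (hs : s = concat (List.replicate k b ++ v) s') (hlt : [a] ++ List.replicate k b < v) :
    Between a b (List.replicate k b) s := by
  constructor
  · rw [omegaPower_eq_concat_two, hs]
    have : (List.replicate k b ++ [a, b]) ++ (List.replicate k b ++ [a, b]) =
        List.replicate k b ++ (([a] ++ List.replicate k b) ++ [b, a, b]) := by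
      have : [b] ++ List.replicate k b = List.replicate k b ++ [b] := by
        rw [← List.replicate_succ', List.singleton_append, List.replicate_succ]
      simpa using congrArg (· ++ [a, b]) this
    rw [this, ← List.append_nil v]
    exact lex_concat_lt_of_append hlt (by simp [hlen]) _ _
  · rw [omegaPower_eq_concat, hs, hv]
    exact lex_concat_lt_of_append (m₁ := v') (m₂ := [a]) (singleton_lt hcb) rfl _ _

lemma between_replicate_right_pred (hab : a < b) {k : ℕ} (hlen : v.length = k + 2)
    (hs : s = concat (List.replicate (k + 1) b ++ v) s')
    (hlt : v < [a] ++ List.replicate (k + 1) b) :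
    Between a b (List.replicate k b) s := by
  constructor
  · refine omegaPower_lt_of_split hab (w := v) (s' := s') ?_
    rw [hs, List.replicate_succ']
    simp
  · rw [omegaPower_eq_concat_two, hs]
    have : (List.replicate k b ++ [b, a]) ++ (List.replicate k b ++ [b, a]) =
        List.replicate (k + 1) b ++ (([a] ++ List.replicate (k + 1) b) ++ [a]) := by
      simp [List.replicate_succ']
    rw [this, ← List.append_nil v]
    exact lex_concat_lt_of_append hlt (by simp [hlen]) _ _

lemma omegaPower_low_lt {x y : ℤ} (hlen : v.length = u.length + 2)
    (hs : s = concat (u ++ [x, y] ++ v) s')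
    (h : ([x, y] = [a, b] ∧ u ++ [a, b] < v) ∨ [a, b] < [x, y]) :
    toLex (omegaPower (u ++ [a, b])) < toLex s := by
  rw [omegaPower_eq_concat_two, hs]
  rcases h with ⟨h1, h2⟩ | h
  · rw [h1]
    exact lex_concat_append_lt h2 (by simp [hlen]) _ _
  · rw [List.append_assoc u, List.append_assoc u]
    exact lex_concat_lt_of_append h rfl _ _

lemma lt_omegaPower_high {x y : ℤ} (hlen : v.length = u.length + 2)
    (hs : s = concat (u ++ [x, y] ++ v) s')
    (h : ([x, y] = [b, a] ∧ v < u ++ [b, a]) ∨ [x, y] < [b, a]) :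
    toLex s < toLex (omegaPower (u ++ [b, a])) := by
  rw [omegaPower_eq_concat_two, hs]
  rcases h with ⟨h1, h2⟩ | h
  · rw [h1]
    exact lex_concat_append_lt h2 (by simp [hlen]) _ _
  · rw [List.append_assoc u, List.append_assoc u]
    exact lex_concat_lt_of_append h rfl _ _

/-- Since `u` has the period `qba`, the word `(qba)^ω` begins with `qbau = uabq`. So after `u` it
remains to compare `xy` with `ab` and then `v` with `q`; as `v` does not begin with `q`, `v < uab =
qba⋯` settles the latter. -/
lemma between_right_factor (hab : a < b) {p q : List ℤ} {x y : ℤ} (h1 : u = p ++ [a, b] ++ q)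
    (h2 : u = q ++ [b, a] ++ p) (hlen : v.length = u.length + 2)
    (hs : s = concat (u ++ [x, y] ++ v) s') (hne : [x, y] = [a, b] → ∀ w, v ≠ q ++ w)
    (h : ([x, y] = [a, b] ∧ v < u ++ [a, b]) ∨ [x, y] < [a, b]) : Between a b q s := by
  constructor
  · refine omegaPower_lt_of_split hab (w := [a] ++ p ++ [x, y] ++ v) (s' := s') ?_
    rw [hs]
    congr 1
    conv_lhs => rw [h2]
    simp
  · obtain ⟨W, hW⟩ := exists_omegaPower_eq_concat (H := q ++ [b, a]) (by simp) h2
      (by rw [h1, List.append_assoc])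
    have e : (q ++ [b, a]) ++ u = u ++ [a, b] ++ q := by
      conv_lhs => rw [h1]
      conv_rhs => rw [h2]
      simp
    rw [omegaPower_eq_concat, hW, ← concat_append, e, hs]
    rcases h with ⟨h3, h4⟩ | h
    · have hlq : q.length ≤ v.length := by
        have := congrArg List.length h1
        simp only [List.length_append] at this
        omega
      rw [h2, List.append_assoc, List.append_assoc] at h4
      obtain ⟨v₁, v₂, rfl, k1, k2⟩ := exists_split_lt hlq h4 (hne h3)
      rw [h3, ← List.append_nil q]
      exact lex_concat_lt_of_append k2 k1 _ _
    · rw [List.append_assoc u, List.append_assoc u]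
      exact lex_concat_lt_of_append h rfl _ _

/-- Mirror image, with `(pab)^ω` beginning with `pabu = ubap`. -/
lemma between_left_factor (hab : a < b) {p q : List ℤ} {x y : ℤ} (h1 : u = p ++ [a, b] ++ q)
    (h2 : u = q ++ [b, a] ++ p) (hlen : v.length = u.length + 2)
    (hs : s = concat (u ++ [x, y] ++ v) s') (hne : [x, y] = [b, a] → ∀ w, v ≠ p ++ w)
    (h : ([x, y] = [b, a] ∧ u ++ [b, a] < v) ∨ [b, a] < [x, y]) : Between a b p s := by
  constructor
  · obtain ⟨W, hW⟩ := exists_omegaPower_eq_concat (H := p ++ [a, b]) (by simp) h1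
      (by rw [h2, List.append_assoc])
    have e : (p ++ [a, b]) ++ u = u ++ [b, a] ++ p := by
      conv_lhs => rw [h2]
      conv_rhs => rw [h1]
      simp
    rw [omegaPower_eq_concat, hW, ← concat_append, e, hs]
    rcases h with ⟨h3, h4⟩ | h
    · have hlq : p.length ≤ v.length := by
        have := congrArg List.length h1
        simp only [List.length_append] at this
        omega
      rw [h1, List.append_assoc, List.append_assoc] at h4
      obtain ⟨v₁, v₂, rfl, k1, k2⟩ := exists_split_gt hlq h4 (hne h3)
      rw [h3, ← List.append_nil p]
      exact lex_concat_lt_of_append k2 k1.symm _ _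
    · rw [List.append_assoc u, List.append_assoc u]
      exact lex_concat_lt_of_append h rfl _ _
  · refine lt_omegaPower_of_split hab (w := [b] ++ q ++ [x, y] ++ v) (s' := s') ?_
    rw [hs]
    congr 1
    conv_lhs => rw [h1]
    simp

end Cases

/-! ### The longest central prefix -/

lemma sum_concat_eq_ediv {a m : ℤ} {n : ℕ} {s : ℕ → ℤ} (h : Slope a m n)
    (hs : Begins (centralWord m n) s) {j : ℕ} (h0 : 0 < j) (h1 : j < n) :
    ∑ i ∈ Finset.range j, concat [a] s i = m * j / n := by
  obtain ⟨N, rfl⟩ := Nat.exists_eq_add_of_lt h0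
  rw [zero_add] at h1 ⊢
  have k1 := sum_mech_num h N
  rw [Finset.sum_range_succ', concat_cons_zero]
  have k2 : ∑ i ∈ Finset.range N, concat [a] s (i + 1) = ∑ i ∈ Finset.range N, mech m n m i := by
    refine Finset.sum_congr rfl fun i hi => ?_
    rw [Finset.mem_range] at hi
    rw [concat_cons_succ, concat_nil, begins_iff.1 hs i (by rw [length_centralWord]; omega)]
    simp [centralWord]
  rw [k2, k1]
  push_cast
  ring

/-- If arbitrarily long prefixes of `s` are central, then `s` is a characteristic word. -/
lemma exists_mechanical_of_unbounded {a : ℤ} (ha : 0 ≤ a) {s : ℕ → ℤ}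
    (h : ∀ N : ℕ, ∃ z, IsCentral a (a + 1) z ∧ Begins z s ∧ N ≤ z.length) :
    ∃ α ∈ Icc (a : ℝ) (a + 1 : ℤ),
      concat [a] s = lowerMechanical α 0 ∨ concat [a + 1] s = upperMechanical α 0 := by
  set C : ℕ → ℤ := fun j => ∑ i ∈ Finset.range j, concat [a] s i with hC
  -- Here `q` is the slope of a long central prefix; `j q` is not an integer for `0 < j < n`, so
  -- both inequalities are strict.
  have hq : ∀ N : ℕ, ∃ q : ℝ, ∀ j : ℕ, 0 < j → j ≤ N → (C j : ℝ) < j * q ∧ j * q < C j + 1 := by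
    intro N
    obtain ⟨z, hz, hzs, hzN⟩ := h N
    obtain ⟨m, n, hS, rfl⟩ := (isCentral_iff ha).1 hz
    rw [length_centralWord] at hzN
    have hn := hS.pos
    have hn2 := hS.two_le
    have hn' : (0 : ℝ) < n := by exact_mod_cast hn
    refine ⟨(m : ℝ) / n, fun j j0 j1 => ?_⟩
    have k0 : C j = m * j / n := sum_concat_eq_ediv hS hzs j0 (by omega)
    have k1 := Int.mul_ediv_add_emod (m * j) n
    have k2 := Int.emod_nonneg (m * j) hn.ne'
    have k3 := Int.emod_lt_of_pos (m * j) hn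
    have k4 : m * j % n ≠ 0 := fun k =>
      hS.not_dvd (by omega) (by omega) (Int.dvd_of_emod_eq_zero k)
    rw [← k0] at k1
    have k5 : C j * n < m * j := by
      have : 0 < m * j % n := by omega
      linarith
    have k6 : m * j < (C j + 1) * n := by linarith
    have k5' : (C j : ℝ) * n < m * j := by exact_mod_cast k5
    have k6' : (m : ℝ) * j < (C j + 1) * n := by exact_mod_cast k6
    have e : (j : ℝ) * (m / n) = m * j / n := by ring
    rw [e]
    exact ⟨by rwa [lt_div_iff₀ hn'], by rwa [div_lt_iff₀ hn']⟩
  have hij : ∀ i j : ℕ, (C (i + 1) : ℝ) / (i + 1 : ℕ) ≤ (C (j + 1) + 1) / (j + 1 : ℕ) := by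
    intro i j
    obtain ⟨q, hq⟩ := hq (max (i + 1) (j + 1))
    have k1 := (hq (i + 1) (by omega) (le_max_left _ _)).1
    have k2 := (hq (j + 1) (by omega) (le_max_right _ _)).2
    have p1 : (0 : ℝ) < (i + 1 : ℕ) := by positivity
    have p2 : (0 : ℝ) < (j + 1 : ℕ) := by positivity
    have k3 : (C (i + 1) : ℝ) / (i + 1 : ℕ) < q := by rw [div_lt_iff₀ p1]; linarith
    have k4 : q < (C (j + 1) + 1) / (j + 1 : ℕ) := by rw [lt_div_iff₀ p2]; linarith
    linarith
  set α : ℝ := ⨆ i : ℕ, (C (i + 1) : ℝ) / (i + 1 : ℕ) with hα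
  have hbdd : BddAbove (range fun i : ℕ => (C (i + 1) : ℝ) / (i + 1 : ℕ)) :=
    ⟨_, by rintro _ ⟨i, rfl⟩; exact hij i 0⟩
  have hlow : ∀ j : ℕ, (C j : ℝ) ≤ j * α := by
    intro j
    cases j with
    | zero => simp [hC]
    | succ j =>
      have := le_ciSup hbdd j
      rw [div_le_iff₀ (by positivity)] at this
      linarith
  have hupp : ∀ j : ℕ, (j : ℝ) * α ≤ C j + 1 := by
    intro j
    cases j with
    | zero => simp [hC]
    | succ j =>
      have : α ≤ (C (j + 1) + 1) / (j + 1 : ℕ) := ciSup_le fun i => hij i j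
      rw [le_div_iff₀ (by positivity)] at this
      linarith
  have hC0 : C 0 = 0 := by simp [hC]
  have hC1 : C 1 = a := by simp [hC]
  have hCs : ∀ i, concat [a] s i = C (i + 1) - C i := by
    intro i; simp only [hC, Finset.sum_range_succ]; ring
  refine ⟨α, ⟨?_, ?_⟩, ?_⟩
  · have := hlow 1
    rw [hC1] at this
    simpa using this
  · have := hupp 1
    rw [hC1] at this
    simpa using this
  -- In the limit, `C j ≤ j α ≤ C j + 1`. If the upper equality never occurs, `C j` is the floor; if
  -- the lower one never occurs for `j > 0`, `C j + 1` is the ceiling.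
  by_cases hA : ∀ j : ℕ, (j : ℝ) * α < C j + 1
  · left
    have hfl : ∀ j : ℕ, ⌊α * j + 0⌋ = C j := by
      intro j
      rw [Int.floor_eq_iff]
      have := hlow j
      have := hA j
      constructor <;> linarith
    funext i
    have k1 := hfl (i + 1)
    have k2 := hfl i
    push_cast at k1
    rw [hCs, lowerMechanical, k1, k2]
  by_cases hB : ∀ j : ℕ, 0 < j → (C j : ℝ) < j * α
  · right
    have hcl : ∀ j : ℕ, 0 < j → ⌈α * j + 0⌉ = C j + 1 := by
      intro j hj
      rw [Int.ceil_eq_iff]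
      have := hB j hj
      have := hupp j
      push_cast
      constructor <;> linarith
    funext i
    have k1 := hcl (i + 1) (by omega)
    push_cast at k1
    rw [upperMechanical, k1]
    cases i with
    | zero =>
      rw [concat_cons_zero, zero_add, hC1]; simp
    | succ i =>
      have k2 := hcl (i + 1) (by omega)
      have k3 := hCs (i + 1)
      rw [concat_cons_succ] at k3 ⊢
      rw [k3, k2]; ring
  exfalso
  push Not at hA hB
  obtain ⟨j, hj⟩ := hA
  obtain ⟨i, hi0, hi⟩ := hB
  have hj0 : 0 < j := by
    rcases Nat.eq_zero_or_pos j with rfl | h0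
    · simp only [hC0, Int.cast_zero, Nat.cast_zero, zero_mul] at hj; linarith
    · exact h0
  -- If both equalities occur, a slope `q` valid up to both indices is at once greater and smaller
  -- than `α`.
  obtain ⟨q, hq⟩ := hq (max i j)
  have k1 := (hq i hi0 (le_max_left _ _)).1
  have k2 := (hq j hj0 (le_max_right _ _)).2
  have p1 : (0 : ℝ) < i := by exact_mod_cast hi0
  have p2 : (0 : ℝ) < j := by exact_mod_cast hj0
  have k3 : α < q := lt_of_mul_lt_mul_left (by linarith : (i : ℝ) * α < i * q) p1.le
  have k4 : q < α := lt_of_mul_lt_mul_left (by linarith : (j : ℝ) * q < j * α) p2.le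
  linarith

lemma exists_isLongestCentral {a : ℤ} (ha : 0 ≤ a) {s : ℕ → ℤ}
    (h : ¬ ∃ α ∈ Icc (a : ℝ) (a + 1 : ℤ),
      concat [a] s = lowerMechanical α 0 ∨ concat [a + 1] s = upperMechanical α 0) :
    ∃ u, IsLongestCentral a (a + 1) s u := by
  classical
  have hb : ∃ N : ℕ, ∀ z, IsCentral a (a + 1) z → Begins z s → z.length ≤ N := by
    by_contra! hc
    refine h (exists_mechanical_of_unbounded ha fun N => ?_)
    obtain ⟨z, h1, h2, h3⟩ := hc N
    exact ⟨z, h1, h2, h3.le⟩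
  obtain ⟨N, hN⟩ := hb
  let P : ℕ → Prop := fun L => ∃ z, IsCentral a (a + 1) z ∧ Begins z s ∧ z.length = L
  have h0 : P 0 := ⟨[], by simpa using isCentral_replicate_left ha 0, ⟨s, by simp⟩, rfl⟩
  obtain ⟨u, hu1, hu2, hu3⟩ := Nat.findGreatest_spec (P := P) (Nat.zero_le N) h0
  refine ⟨u, hu1, hu2, fun w hw1 hw2 => ?_⟩
  rw [hu3]
  exact Nat.le_findGreatest (hN w hw1 hw2) ⟨w, hw1, hw2, rfl⟩

/-! ### The invariant orbit closure -/

lemma sum_eq_of_two_letters {a : ℤ} {l : List ℤ} (h : ∀ x ∈ l, x = a ∨ x = a + 1) :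
    l.sum = a * l.length + l.count (a + 1) := by
  induction l with
  | nil => simp
  | cons x l ih =>
    have := ih fun y hy => h y (List.mem_cons_of_mem _ hy)
    rw [List.sum_cons, this, List.length_cons, List.count_cons]
    rcases h x List.mem_cons_self with rfl | rfl
    · simp; ring
    · simp; ring

/-- The period `b z a` of slope `m / n`, when the expansion of `t` lies between the words given
by the central word `z`. -/
theorem containsOrbit_of_between {β t : ℝ} {a b : ℤ} {s : ℕ → ℤ} (hβ : 1 < β) (ht1 : t ≤ 1 - 1 / β)
    (ha : 0 ≤ a) (hab : a = b - 1) (hd : dbar β t = concat [a] s) {z : List ℤ}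
    (hz : IsCentral a b z) (hs : Between a b z s) :
    ContainsOrbit β t ([b] ++ z ++ [a]) ((a : ℝ) + ((z.count b : ℝ) + 1) / ((z.length : ℝ) + 2)) ∧
      ∃! S : Set ℝ, IsInvariantOrbitClosure β S ∧ S ⊆ Icc t (t + 1 / β) := by
  obtain rfl : b = a + 1 := by omega
  obtain ⟨m, n, hS, rfl⟩ := (isCentral_iff ha).1 hz
  have hn : 0 < n := by have := hS.two_le; omega
  have htail : dbar β (Tbar β t) = s := by
    funext k
    rw [← dbar_succ, hd]; simp
  have hE : Encloses β t a m n :=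
    { one_lt := hβ
      le_one_sub := ht1
      nonneg := ha
      two_le := by exact_mod_cast hS.two_le
      coprime := hS.coprime
      div_eq := hS.div_eq
      digit := by rw [hd]; simp
      lower := by
        rw [htail, ← omegaPower_map_mech hn, hS.append_low_high]; exact hs.1
      upper := by
        rw [htail, ← omegaPower_map_mech hn m, hS.append_high_low]; exact hs.2 }
  have hw : wordValue β (omegaPower ([a + 1] ++ centralWord m n ++ [a])) = mechValue β m n (-1) := by
    rw [← hS.upper_eq, omegaPower_map_mech hn]; rfl
  -- A period of the word has length `n` and sum `m`; counting its letters `a + 1` gives the same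
  -- sum.
  have hf : (a : ℝ) + (((centralWord m n).count (a + 1) : ℝ) + 1) /
      (((centralWord m n).length : ℝ) + 2) = (m : ℝ) / n := by
    have k1 : ((List.range n).map (mech m n (-1))).sum = m := by
      have := sum_mech (m := m) (n := n) (-1) n
      rw [add_comm, Int.add_mul_ediv_right _ _ hS.pos.ne', add_sub_cancel_left] at this
      exact this
    have k2 : ∀ x ∈ [a + 1] ++ centralWord m n ++ [a], x = a ∨ x = a + 1 := by
      rw [← hS.upper_eq]
      intro x hx
      obtain ⟨i, -, rfl⟩ := List.mem_map.1 hx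
      exact mech_eq_or hS.pos hS.div_eq _ _
    have k3 := sum_eq_of_two_letters k2
    rw [← hS.upper_eq, k1, hS.upper_eq] at k3
    have k4 : ([a + 1] ++ centralWord m n ++ [a]).count (a + 1) =
        (centralWord m n).count (a + 1) + 1 := by
      simp
    have k5 : ([a + 1] ++ centralWord m n ++ [a]).length = n := by
      have := hS.two_le
      simp [length_centralWord]; omega
    have k6 : ((centralWord m n).length : ℝ) + 2 = n := by
      have := hS.two_le
      have : (centralWord m n).length + 2 = n := by rw [length_centralWord]; omega
      exact_mod_cast this
    rw [k4, k5] at k3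
    have k7 : (m : ℝ) = a * n + ((centralWord m n).count (a + 1) + 1) := by exact_mod_cast k3
    have hn' : (0 : ℝ) < n := by exact_mod_cast hn
    rw [k6, eq_div_iff hn'.ne', add_mul, div_mul_cancel₀ _ hn'.ne', ← k7]
  refine ⟨?_, range (mechValue β m n), ⟨hE.isInvariantOrbitClosure, hE.range_subset⟩,
    fun S hS => hE.eq_range_of_isInvariantOrbitClosure hS.1 hS.2⟩
  unfold ContainsOrbit
  rw [hw, hE.orbitClosure_eq, hf]
  exact ⟨hE.isInvariantOrbitClosure, hE.range_subset, hE.setHasFrequency⟩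

/-! ### What follows the longest central prefix -/

section LongestCentral

variable {a : ℤ} {s : ℕ → ℤ} {u v : List ℤ} {s' : ℕ → ℤ}

lemma eq_nil_of_isLongestCentral {b : ℤ} {w r : List ℤ} (hu : IsLongestCentral a b s u)
    (hc : IsCentral a b (u ++ w)) (hs : s = concat (u ++ (w ++ r)) s') : w = [] := by
  have h1 := hu.2.2 _ hc ⟨concat r s', by rw [hs, ← List.append_assoc, concat_append]⟩
  rw [List.length_append] at h1
  exact List.length_eq_zero_iff.1 (by omega)

lemma const_eq_concat (c : ℤ) (k : ℕ) :
    (fun _ : ℕ => c) = concat (List.replicate k c) (fun _ => c) := by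
  obtain ⟨r, hr⟩ : Begins (List.replicate k c) (fun _ : ℕ => c) := begins_iff.2 fun i h => by simp
  funext i
  unfold concat
  split_ifs <;> simp

lemma lt_const_of_lt {k : ℕ} (hlen : v.length = k + 1)
    (hs : s = concat (List.replicate k a ++ v) s') (h : v < List.replicate (k + 1) a) :
    toLex s < toLex (fun _ : ℕ => a) := by
  rw [const_eq_concat a (k + (k + 1)), ← List.replicate_append_replicate, hs]
  exact lex_concat_append_lt h (by simp [hlen]) _ _

lemma const_lt_of_lt {k : ℕ} (hlen : v.length = k + 1)
    (hs : s = concat (List.replicate k a ++ v) s') (h : List.replicate (k + 1) a < v) :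
    toLex (fun _ : ℕ => a) < toLex s := by
  rw [const_eq_concat a (k + (k + 1)), ← List.replicate_append_replicate, hs]
  exact lex_concat_append_lt h (by simp [hlen]) _ _

/-- The word that follows the longest central prefix `a ^ k`. -/
lemma exists_cons_of_replicate_left (ha : 0 ≤ a) {k : ℕ}
    (hu : IsLongestCentral a (a + 1) s (List.replicate k a)) (hlen : v.length = k + 1)
    (hs : s = concat (List.replicate k a ++ v) s') : ∃ c v', v = c :: v' ∧ c ≠ a := by
  obtain _ | ⟨c, v'⟩ := v
  · simp at hlen
  · refine ⟨c, v', rfl, ?_⟩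
    rintro rfl
    have := eq_nil_of_isLongestCentral (w := [c]) (r := v') hu (by
      rw [← List.replicate_succ']; exact isCentral_replicate_left ha _) hs
    simp at this

lemma exists_cons_of_replicate_right (ha : 0 ≤ a) {k : ℕ}
    (hu : IsLongestCentral a (a + 1) s (List.replicate k (a + 1))) (hlen : v.length = k + 1)
    (hs : s = concat (List.replicate k (a + 1) ++ v) s') : ∃ c v', v = c :: v' ∧ c ≠ a + 1 := by
  obtain _ | ⟨c, v'⟩ := v
  · simp at hlen
  · refine ⟨c, v', rfl, ?_⟩
    intro hc
    subst hc
    have := eq_nil_of_isLongestCentral (w := [a + 1]) (r := v') hu (by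
      rw [← List.replicate_succ']; exact isCentral_replicate_right ha _) hs
    simp at this

lemma replicate_left_cases (ha : 0 ≤ a) {k : ℕ}
    (hu : IsLongestCentral a (a + 1) s (List.replicate (k + 1) a)) (hlen : v.length = k + 2)
    (hs : s = concat (List.replicate (k + 1) a ++ v) s') :
    v ≠ List.replicate (k + 2) a ∧ v ≠ [a + 1] ++ List.replicate (k + 1) a ∧
    (v < List.replicate (k + 2) a → toLex s < toLex (fun _ : ℕ => a)) ∧
    (List.replicate (k + 2) a < v ∧ v < [a + 1] ++ List.replicate (k + 1) a →
      Between a (a + 1) (List.replicate (k + 1) a) s) ∧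
    (v > [a + 1] ++ List.replicate (k + 1) a → Between a (a + 1) (List.replicate k a) s) := by
  obtain ⟨c, v', hv, hc⟩ := exists_cons_of_replicate_left ha hu hlen hs
  refine ⟨?_, ?_, lt_const_of_lt hlen hs, fun h => ?_, ?_⟩
  · rw [hv, List.replicate_succ]
    intro h
    exact hc (List.cons.inj h).1
  · intro h
    have := eq_nil_of_isLongestCentral (r := []) hu (isCentral_left_middle ha k)
      (s' := s') (by rw [List.append_nil, hs, h])
    simp at this
  · refine between_replicate_left ?_ hv hlen hs h.2
    rw [hv, List.replicate_succ] at h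
    rcases List.cons_lt_cons_iff.1 h.1 with h' | ⟨h', -⟩
    · exact h'
    · exact absurd h'.symm hc
  · exact between_replicate_left_pred (by omega) hlen hs

lemma replicate_right_cases (ha : 0 ≤ a) {k : ℕ}
    (hu : IsLongestCentral a (a + 1) s (List.replicate (k + 1) (a + 1))) (hlen : v.length = k + 2)
    (hs : s = concat (List.replicate (k + 1) (a + 1) ++ v) s') :
    v ≠ List.replicate (k + 2) (a + 1) ∧ v ≠ [a] ++ List.replicate (k + 1) (a + 1) ∧
    (v > List.replicate (k + 2) (a + 1) → toLex (fun _ : ℕ => a + 1) < toLex s) ∧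
    ([a] ++ List.replicate (k + 1) (a + 1) < v ∧ v < List.replicate (k + 2) (a + 1) →
      Between a (a + 1) (List.replicate (k + 1) (a + 1)) s) ∧
    (v < [a] ++ List.replicate (k + 1) (a + 1) →
      Between a (a + 1) (List.replicate k (a + 1)) s) := by
  obtain ⟨c, v', hv, hc⟩ := exists_cons_of_replicate_right ha hu hlen hs
  refine ⟨?_, ?_, const_lt_of_lt hlen hs, fun h => ?_, ?_⟩
  · rw [hv, List.replicate_succ]
    intro h
    exact hc (List.cons.inj h).1
  · intro h
    have := eq_nil_of_isLongestCentral (r := []) hu (isCentral_right_middle ha k)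
      (s' := s') (by rw [List.append_nil, hs, h])
    simp at this
  · refine between_replicate_right ?_ hv hlen hs h.1
    rw [hv, List.replicate_succ] at h
    rcases List.cons_lt_cons_iff.1 h.2 with h' | ⟨h', -⟩
    · exact h'
    · exact absurd h' hc
  · exact between_replicate_right_pred (by omega) hlen hs

/-- By `isCentral_extend`, maximality of `u` forbids `q` after `uab` and `p` after `uba`. As `u`
begins with both `q` and `p`, this also excludes the two equalities for `v`. -/
lemma pair_cases (ha : 0 ≤ a) {p q : List ℤ} {x y : ℤ} (hu : IsLongestCentral a (a + 1) s u)
    (hpq : IsCentralPair a (a + 1) u p q) (hlen : v.length = u.length + 2)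
    (hs : s = concat (u ++ [x, y] ++ v) s') :
    ([x, y] = [a, a + 1] → v ≠ u ++ [a, a + 1]) ∧ ([x, y] = [a + 1, a] → v ≠ u ++ [a + 1, a]) ∧
    (([x, y] = [a, a + 1] ∧ v > u ++ [a, a + 1]) ∨ ([a, a + 1] < [x, y] ∧ [x, y] < [a + 1, a]) ∨
      ([x, y] = [a + 1, a] ∧ v < u ++ [a + 1, a]) → Between a (a + 1) u s) ∧
    (([x, y] = [a, a + 1] ∧ v < u ++ [a, a + 1]) ∨ [x, y] ≤ [a, a] → Between a (a + 1) q s) ∧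
    (([x, y] = [a + 1, a] ∧ v > u ++ [a + 1, a]) ∨ [x, y] ≥ [a + 1, a + 1] →
      Between a (a + 1) p s) := by
  obtain ⟨c1, c2⟩ := isCentral_extend ha hu.1 hpq
  obtain ⟨-, -, e1, e2⟩ := hpq
  have n1 : [x, y] = [a, a + 1] → ∀ w, v ≠ q ++ w := by
    rintro h w rfl
    rw [List.append_assoc] at c1
    have := eq_nil_of_isLongestCentral (r := w) hu c1 (s' := s') (by rw [hs, h]; simp)
    simp at this
  have n2 : [x, y] = [a + 1, a] → ∀ w, v ≠ p ++ w := by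
    rintro h w rfl
    rw [List.append_assoc] at c2
    have := eq_nil_of_isLongestCentral (r := w) hu c2 (s' := s') (by rw [hs, h]; simp)
    simp at this
  have l1 : ([a, a + 1] : List ℤ) < [a + 1, a] := List.cons_lt_cons_iff.2 (Or.inl (by omega))
  have l2 : ([a, a] : List ℤ) < [a, a + 1] :=
    List.cons_lt_cons_iff.2 (Or.inr ⟨rfl, singleton_lt (by omega)⟩)
  have l3 : ([a + 1, a] : List ℤ) < [a + 1, a + 1] :=
    List.cons_lt_cons_iff.2 (Or.inr ⟨rfl, singleton_lt (by omega)⟩)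
  refine ⟨fun h h' => ?_, fun h h' => ?_, fun h => ⟨?_, ?_⟩, fun h => ?_, fun h => ?_⟩
  · exact n1 h ([a + 1, a] ++ p ++ [a, a + 1]) (by rw [h', e2]; simp)
  · exact n2 h ([a, a + 1] ++ q ++ [a + 1, a]) (by rw [h', e1]; simp)
  · refine omegaPower_low_lt hlen hs ?_
    rcases h with h | h | h
    · exact Or.inl h
    · exact Or.inr h.1
    · exact Or.inr (h.1 ▸ l1)
  · refine lt_omegaPower_high hlen hs ?_
    rcases h with h | h | h
    · exact Or.inr (h.1 ▸ l1)
    · exact Or.inr h.2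
    · exact Or.inl h
  · refine between_right_factor (by omega) e1 e2 hlen hs n1 ?_
    rcases h with h | h
    · exact Or.inl h
    · exact Or.inr (lt_of_le_of_lt h l2)
  · refine between_left_factor (by omega) e1 e2 hlen hs n2 ?_
    rcases h with h | h
    · exact Or.inl h
    · exact Or.inr (lt_of_lt_of_le l3 h)

/-- A single letter `a` or `a + 1` is central, so `u` is not empty and its exponent as a power is at
least 1. -/
lemma isLongestCentral_cases (ha : 0 ≤ a) (h0 : a ≤ s 0) (h1 : s 0 ≤ a + 1)
    (hu : IsLongestCentral a (a + 1) s u) :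
    (∃ k : ℕ, u = List.replicate (k + 1) a) ∨ (∃ k : ℕ, u = List.replicate (k + 1) (a + 1)) ∨
      ∃ p q, IsCentralPair a (a + 1) u p q := by
  have hne : u ≠ [] := by
    rintro rfl
    have hb : Begins [s 0] s := begins_iff.2 fun i hi => by
      simp only [List.length_singleton, Nat.lt_one_iff] at hi
      subst hi
      rfl
    have hc : IsCentral a (a + 1) [s 0] := by
      rcases (by omega : s 0 = a ∨ s 0 = a + 1) with h | h
      · rw [h]; exact isCentral_replicate_left ha 1
      · rw [h]; exact isCentral_replicate_right ha 1
    have := hu.2.2 _ hc hb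
    simp at this
  rcases isCentral_cases ha hu.1 with ⟨k, rfl⟩ | ⟨k, rfl⟩ | h
  · obtain _ | k := k
    · exact absurd rfl hne
    · exact Or.inl ⟨k, rfl⟩
  · obtain _ | k := k
    · exact absurd rfl hne
    · exact Or.inr (Or.inl ⟨k, rfl⟩)
  · exact Or.inr (Or.inr h)

lemma exists_central_between (ha : 0 ≤ a) (h1 : toLex (fun _ : ℕ => a) < toLex s)
    (h2 : toLex s < toLex (fun _ : ℕ => a + 1)) (hu : IsLongestCentral a (a + 1) s u) :
    ∃ z, IsCentral a (a + 1) z ∧ Between a (a + 1) z s := by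
  obtain ⟨r, hr⟩ := hu.2.1
  rcases isLongestCentral_cases ha (apply_zero_le_of_lex_lt h1) (apply_zero_le_of_lex_lt h2) hu with
    ⟨k, rfl⟩ | ⟨k, rfl⟩ | ⟨p, q, hpq⟩
  · obtain ⟨v, s', hlen, rfl⟩ := exists_concat r (k + 2)
    rw [← concat_append] at hr
    obtain ⟨c1, c2, c3, c4, c5⟩ := replicate_left_cases ha hu hlen hr
    rcases lt_trichotomy v (List.replicate (k + 2) a) with h | h | h
    · exact absurd (c3 h) h1.asymm
    · exact absurd h c1
    · rcases lt_trichotomy v ([a + 1] ++ List.replicate (k + 1) a) with h' | h' | h'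
      · exact ⟨_, isCentral_replicate_left ha _, c4 ⟨h, h'⟩⟩
      · exact absurd h' c2
      · exact ⟨_, isCentral_replicate_left ha _, c5 h'⟩
  · obtain ⟨v, s', hlen, rfl⟩ := exists_concat r (k + 2)
    rw [← concat_append] at hr
    obtain ⟨c1, c2, c3, c4, c5⟩ := replicate_right_cases ha hu hlen hr
    rcases lt_trichotomy v (List.replicate (k + 2) (a + 1)) with h | h | h
    · rcases lt_trichotomy v ([a] ++ List.replicate (k + 1) (a + 1)) with h' | h' | h'
      · exact ⟨_, isCentral_replicate_right ha _, c5 h'⟩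
      · exact absurd h' c2
      · exact ⟨_, isCentral_replicate_right ha _, c4 ⟨h', h⟩⟩
    · exact absurd h c1
    · exact absurd (c3 h) h2.asymm
  · obtain ⟨w, r', hw, rfl⟩ := exists_concat r 2
    obtain ⟨v, s', hlen, rfl⟩ := exists_concat r' (u.length + 2)
    obtain ⟨x, y, rfl⟩ := List.length_eq_two.1 hw
    rw [← concat_append, ← concat_append] at hr
    obtain ⟨c1, c2, c3, c4, c5⟩ := pair_cases ha hu hpq hlen hr
    rcases lt_trichotomy [x, y] [a, a + 1] with h | h | h
    -- Letters are integers, so `xy < ab` already forces `xy ≤ aa`.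
    · refine ⟨q, hpq.2.1, c4 (Or.inr ?_)⟩
      rcases List.cons_lt_cons_iff.1 h with l | ⟨rfl, l⟩
      · exact (List.cons_lt_cons_iff.2 (Or.inl l)).le
      · have hy : y ≤ x := by
          rcases List.cons_lt_cons_iff.1 l with h' | ⟨-, h'⟩
          · omega
          · exact absurd h' (lt_irrefl _)
        rcases hy.lt_or_eq with hy | rfl
        · exact (List.cons_lt_cons_iff.2 (Or.inr ⟨rfl, singleton_lt hy⟩)).le
        · exact le_rfl
    · rcases lt_trichotomy v (u ++ [a, a + 1]) with h' | h' | h'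
      · exact ⟨q, hpq.2.1, c4 (Or.inl ⟨h, h'⟩)⟩
      · exact absurd h' (c1 h)
      · exact ⟨u, hu.1, c3 (Or.inl ⟨h, h'⟩)⟩
    · rcases lt_trichotomy [x, y] [a + 1, a] with k | k | k
      · exact ⟨u, hu.1, c3 (Or.inr (Or.inl ⟨h, k⟩))⟩
      · rcases lt_trichotomy v (u ++ [a + 1, a]) with h' | h' | h'
        · exact ⟨u, hu.1, c3 (Or.inr (Or.inr ⟨k, h'⟩))⟩
        · exact absurd h' (c2 k)
        · exact ⟨p, hpq.1, c5 (Or.inl ⟨k, h'⟩)⟩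
      · refine ⟨p, hpq.1, c5 (Or.inr ?_)⟩
        rcases List.cons_lt_cons_iff.1 k with l | ⟨rfl, l⟩
        · exact (List.cons_lt_cons_iff.2 (Or.inl l)).le
        · have hy : a + 1 ≤ y := by
            rcases List.cons_lt_cons_iff.1 l with k' | ⟨-, k'⟩
            · omega
            · exact absurd k' (lt_irrefl _)
          rcases hy.lt_or_eq with hy | rfl
          · exact (List.cons_lt_cons_iff.2 (Or.inr ⟨rfl, singleton_lt hy⟩)).le
          · exact le_rfl

end LongestCentral

end BetaBar

theorem theorem3 (β t : ℝ) (hβ : 1 < β) (ht0 : 0 ≤ t) (ht1 : t ≤ 1 - 1 / β)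
    (a b : ℤ) (s : ℕ → ℤ) (ha : 0 ≤ a) (hab : a = b - 1)
    (hd : dbar β t = concat [a] s)
    (h1 : ¬ toLex s ≤ toLex (fun _ : ℕ => a))
    (h2 : ¬ toLex s ≥ toLex (fun _ : ℕ => b))
    (h3 : ¬ ∃ α ∈ Set.Icc (a : ℝ) (b : ℝ),
      concat [a] s = lowerMechanical α 0 ∨ concat [b] s = upperMechanical α 0) :
    -- the interval contains exactly one invariant orbit closure
    (∃! S : Set ℝ, IsInvariantOrbitClosure β S ∧ S ⊆ Set.Icc t (t + 1 / β)) ∧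
    -- the longest central initial segment of `s` exists
    (∃ u : List ℤ, IsLongestCentral a b s u) ∧
    ∀ u : List ℤ, IsLongestCentral a b s u →
      -- one of the three cases below occurs
      ((∃ k : ℕ, 1 ≤ k ∧ u = List.replicate k a) ∨
        (∃ k : ℕ, 1 ≤ k ∧ u = List.replicate k b) ∨
        (∃! pq : List ℤ × List ℤ, IsCentralPair a b u pq.1 pq.2)) ∧
      -- first case
      (∀ (k : ℕ) (v : List ℤ) (s' : ℕ → ℤ), 1 ≤ k → u = List.replicate k a →
        v.length = k + 1 → s = concat (u ++ v) s' →
        v ≠ List.replicate (k + 1) a ∧ v ≠ [b] ++ List.replicate k a ∧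
        (v < List.replicate (k + 1) a → toLex s ≤ toLex (fun _ : ℕ => a)) ∧
        (List.replicate (k + 1) a < v ∧ v < [b] ++ List.replicate k a →
          ContainsOrbit β t ([b] ++ List.replicate (k + 1) a) ((a : ℝ) + 1 / ((k : ℝ) + 2))) ∧
        (v > [b] ++ List.replicate k a →
          ContainsOrbit β t ([b] ++ List.replicate k a) ((a : ℝ) + 1 / ((k : ℝ) + 1)))) ∧
      -- second case
      (∀ (k : ℕ) (v : List ℤ) (s' : ℕ → ℤ), 1 ≤ k → u = List.replicate k b →
        v.length = k + 1 → s = concat (u ++ v) s' →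
        v ≠ List.replicate (k + 1) b ∧ v ≠ [a] ++ List.replicate k b ∧
        (v > List.replicate (k + 1) b → toLex s ≥ toLex (fun _ : ℕ => b)) ∧
        ([a] ++ List.replicate k b < v ∧ v < List.replicate (k + 1) b →
          ContainsOrbit β t (List.replicate (k + 1) b ++ [a]) ((b : ℝ) - 1 / ((k : ℝ) + 2))) ∧
        (v < [a] ++ List.replicate k b →
          ContainsOrbit β t (List.replicate k b ++ [a]) ((b : ℝ) - 1 / ((k : ℝ) + 1)))) ∧
      -- third case
      (∀ (p q : List ℤ) (x y : ℤ) (v : List ℤ) (s' : ℕ → ℤ), IsCentralPair a b u p q →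
        v.length = u.length + 2 → s = concat (u ++ [x, y] ++ v) s' →
        ([x, y] = [a, b] → v ≠ u ++ [a, b]) ∧ ([x, y] = [b, a] → v ≠ u ++ [b, a]) ∧
        (([x, y] = [a, b] ∧ v > u ++ [a, b]) ∨ ([a, b] < [x, y] ∧ [x, y] < [b, a]) ∨
            ([x, y] = [b, a] ∧ v < u ++ [b, a]) →
          ContainsOrbit β t ([b] ++ u ++ [a])
            ((a : ℝ) + ((u.count b : ℝ) + 1) / ((u.length : ℝ) + 2))) ∧
        (([x, y] = [a, b] ∧ v < u ++ [a, b]) ∨ [x, y] ≤ [a, a] →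
          ContainsOrbit β t ([b] ++ q ++ [a])
            ((a : ℝ) + ((q.count b : ℝ) + 1) / ((q.length : ℝ) + 2))) ∧
        (([x, y] = [b, a] ∧ v > u ++ [b, a]) ∨ [x, y] ≥ [b, b] →
          ContainsOrbit β t ([b] ++ p ++ [a])
            ((a : ℝ) + ((p.count b : ℝ) + 1) / ((p.length : ℝ) + 2)))) := by

  obtain rfl : b = a + 1 := by omega
  have g1 : toLex (fun _ : ℕ => a) < toLex s := not_le.1 h1
  have g2 : toLex s < toLex (fun _ : ℕ => a + 1) := not_le.1 h2
  have hex : ∃ u : List ℤ, IsLongestCentral a (a + 1) s u := exists_isLongestCentral ha h3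
  have orbit : ∀ z, IsCentral a (a + 1) z → Between a (a + 1) z s → _ := fun z hz hs =>
    containsOrbit_of_between hβ ht1 ha hab hd hz hs
  refine ⟨?_, hex, fun u hu => ⟨?_, ?_, ?_, ?_⟩⟩
  · obtain ⟨u, hu⟩ := hex
    obtain ⟨z, hz, hs⟩ := exists_central_between ha g1 g2 hu
    exact (orbit z hz hs).2
  · rcases isLongestCentral_cases ha (apply_zero_le_of_lex_lt g1) (apply_zero_le_of_lex_lt g2) hu with
      ⟨k, hk⟩ | ⟨k, hk⟩ | ⟨p, q, hpq⟩
    · exact Or.inl ⟨k + 1, by omega, hk⟩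
    · exact Or.inr (Or.inl ⟨k + 1, by omega, hk⟩)
    · refine Or.inr (Or.inr ⟨(p, q), hpq, ?_⟩)
      rintro ⟨p', q'⟩ h'
      obtain ⟨rfl, rfl⟩ := isCentralPair_unique ha hu.1 hpq h'
      rfl
  · rintro k v s' hk rfl hlen hs
    obtain ⟨k, rfl⟩ := Nat.exists_eq_add_of_le' hk
    obtain ⟨c1, c2, c3, c4, c5⟩ := replicate_left_cases ha hu hlen hs
    refine ⟨c1, c2, fun h => (c3 h).le, fun h => ?_, fun h => ?_⟩
    · have := (orbit _ (isCentral_replicate_left ha _) (c4 h)).1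
      rw [List.count_replicate, List.length_replicate, List.append_assoc,
        ← List.replicate_succ'] at this
      simpa using this
    -- The bounding central word is one letter shorter than `u`, so the final `a` of the period
    -- restores the exponent of `u`.
    · have := (orbit _ (isCentral_replicate_left ha _) (c5 h)).1
      rw [List.count_replicate, List.length_replicate, List.append_assoc,
        ← List.replicate_succ'] at this
      have e : ((k + 1 : ℕ) : ℝ) + 1 = k + 2 := by push_cast; ring
      rw [e]
      simpa using this
  · rintro k v s' hk rfl hlen hs
    obtain ⟨k, rfl⟩ := Nat.exists_eq_add_of_le' hk
    obtain ⟨c1, c2, c3, c4, c5⟩ := replicate_right_cases ha hu hlen hs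
    refine ⟨c1, c2, fun h => (c3 h).le, fun h => ?_, fun h => ?_⟩
    · have := (orbit _ (isCentral_replicate_right ha _) (c4 h)).1
      rw [List.count_replicate_self, List.length_replicate, List.singleton_append,
        ← List.replicate_succ] at this
      convert this using 1
      push_cast
      field_simp
      ring
    · have := (orbit _ (isCentral_replicate_right ha _) (c5 h)).1
      rw [List.count_replicate_self, List.length_replicate, List.singleton_append,
        ← List.replicate_succ] at this
      convert this using 1
      push_cast
      field_simp
      ring
  · intro p q x y v s' hpq hlen hs
    obtain ⟨c1, c2, c3, c4, c5⟩ := pair_cases ha hu hpq hlen hs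
    exact ⟨c1, c2, fun h => (orbit _ hu.1 (c3 h)).1, fun h => (orbit _ hpq.2.1 (c4 h)).1,
      fun h => (orbit _ hpq.1 (c5 h)).1⟩
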